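/- Let $\mathbf X=(X_t)_{t\in\mathbb Z}$ be a strictly stationary real-valued process on a probability space $(\Omega,\mathcal F,\mathbb P)$ which is $\beta$-mixing: $\beta(m)\to 0$ as $m\to\infty$, where $\beta(m)$ is the total variation distance $\sup_C|\mathbb P_{t\otimes t+m}(C)-(\mathbb P_t\times\mathbb P_{t+m})(C)|$ between the joint law of $(X_s)_{s\le t}$ and $(X_s)_{s\ge t+m}$ and the product of their marginal laws (it does not depend on $t$). Let $M\ge 0$ and let $\ell(y,y')=\min\{(y-y')^2,M\}$ be the squared error loss truncated at $M$. For an AR(1) predictor with coefficient $\phi$ in the stability domain $\mathcal B_1=\{\phi:|\phi|<1\}$ (it forecasts $X_{t+1}$ by $\phi X_t$), let $$R(\phi)=\mathbb E\,\ell(X_{n+1},\phi X_n),\qquad \widehat R_n(\phi)=\frac1n\sum_{t=1}^n\ell(X_{t+1},\phi X_t)$$ be its risk and its training error. Let $\mu,m\ge 1$ be integers with $2\mu m=n$, let $\eta>4(\mu-1)\beta(m)$, and let $\mathcal I=\{\lfloor m/2\rfloor+2mk:\ 0\le k<\mu\}$. (1) With $\eta'=\eta-4(\mu-1)\beta(m)$,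 with probability at least $1-\eta$, simultaneously for all $\phi\in\mathcal B_1$ (hence for any coefficient $\widehat\phi\in\mathcal B_1$ fitted to the data), $$R(\phi)\le\widehat R_n(\phi)+\frac4\mu\sqrt{\frac M2}\Big(\sum_{i\in\mathcal I}X_i^2\Big)^{1/2}+3M\sqrt{\frac{\ln(4/\eta')}{2\mu}}.$$ (2) With $\eta'=\eta-2(\mu-1)\beta(m)$, with probability at least $1-\eta$, simultaneously for all $\phi\in\mathcal B_1$, $$R(\phi)\le\widehat R_n(\phi)+\frac4\mu\sqrt{\frac M2}\;\mathbb E\Big[\Big(\sum_{i\in\mathcal I}X_i^2\Big)^{1/2}\Big]+M\sqrt{\frac{\ln(2/\eta')}{2\mu}}.$$ (If $\eta\ge 1$ both assertions are void.) -/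

import Mathlib

open MeasureTheory Filter Topology

noncomputable section

namespace ARRisk

/-- Strict stationarity of a two-sided real process: for all `t` and all `i, j ≥ 0` the blocks
`(X_t, …, X_{t+i})` and `(X_{t+j}, …, X_{t+i+j})` have the same law. -/
def IsStationary {Ω : Type*} [MeasurableSpace Ω] (P : Measure Ω) (X : ℤ → Ω → ℝ) : Prop :=
  ∀ (t : ℤ) (i j : ℕ),
    P.map (fun ω (k : Fin (i + 1)) => X (t + (k : ℤ)) ω) =
      P.map (fun ω (k : Fin (i + 1)) => X (t + (j : ℤ) + (k : ℤ)) ω)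

/-- The past `(X_s)_{s ≤ t}` of the process. -/
def past {Ω : Type*} (X : ℤ → Ω → ℝ) (t : ℤ) (ω : Ω) : {s : ℤ // s ≤ t} → ℝ :=
  fun s => X s ω

/-- The future `(X_s)_{s ≥ t}` of the process. -/
def future {Ω : Type*} (X : ℤ → Ω → ℝ) (t : ℤ) (ω : Ω) : {s : ℤ // t ≤ s} → ℝ :=
  fun s => X s ω

/-- The `β`-mixing coefficient `β(m)`: the total variation distance (the supremum over all events
of the difference of probabilities) between the joint law of the past up to time `t` and the future
from time `t + m` on, and the product of the two marginal laws.  The supremum over `t` is also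
taken; for a stationary process the distance does not depend on `t`. -/
def betaCoeff {Ω : Type*} [MeasurableSpace Ω] (P : Measure Ω) (X : ℤ → Ω → ℝ) (m : ℕ) : ℝ :=
  ⨆ q : (Σ t : ℤ, {C : Set (({s : ℤ // s ≤ t} → ℝ) × ({s : ℤ // t + (m : ℤ) ≤ s} → ℝ)) //
      MeasurableSet C}),
    |(P.map (fun ω => (past X q.1 ω, future X (q.1 + (m : ℤ)) ω))).real q.2.1 -
      ((P.map (past X q.1)).prod (P.map (future X (q.1 + (m : ℤ))))).real q.2.1|

/-- Absolute regularity: `β(m) → 0`. -/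
def IsBetaMixing {Ω : Type*} [MeasurableSpace Ω] (P : Measure Ω) (X : ℤ → Ω → ℝ) : Prop :=
  Tendsto (betaCoeff P X) atTop (𝓝 0)

/-- The stability domain `B_p`: all complex roots of
`Q_p(z) = z^p - φ_1 z^{p-1} - ⋯ - φ_p` lie strictly inside the unit circle
(`φ i` is the coefficient `φ_{i+1}`). -/
def stabilityDomain (p : ℕ) : Set (Fin p → ℝ) :=
  {φ | ∀ z : ℂ, z ^ p - ∑ i : Fin p, (φ i : ℂ) * z ^ (p - ((i : ℕ) + 1)) = 0 → ‖z‖ < 1}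

/-- For `p = 1` the stability domain is `|φ_1| < 1`. -/
theorem mem_stabilityDomain_one (φ : Fin 1 → ℝ) : φ ∈ stabilityDomain 1 ↔ |φ 0| < 1 := by
  simp [stabilityDomain, sub_eq_zero]

/-- The one-step-ahead AR(`p`) forecast of `x_{t+1}` from `x_t, x_{t-1}, …, x_{t-p+1}`. -/
def arForecast {p : ℕ} (φ : Fin p → ℝ) (x : ℤ → ℝ) (t : ℤ) : ℝ :=
  ∑ i : Fin p, φ i * x (t - (i : ℤ))

/-- Squared error loss truncated at `M`. -/
def truncLoss (M y y' : ℝ) : ℝ := min ((y - y') ^ 2) M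

/-- The risk `R(f) = E[ℓ(X_{n+1}, f(X_1, …, X_n))]` of the AR predictor with coefficients `φ`. -/
def risk {Ω : Type*} [MeasurableSpace Ω] (P : Measure Ω) (X : ℤ → Ω → ℝ) (M : ℝ) (n : ℕ)
    {p : ℕ} (φ : Fin p → ℝ) : ℝ :=
  ∫ ω, truncLoss M (X ((n : ℤ) + 1) ω) (arForecast φ (fun s => X s ω) (n : ℤ)) ∂P

/-- The training error `(1/n) ∑_{t=1}^n ℓ(X_{t+1}, f(X_1, …, X_t))`. -/
def trainingError {Ω : Type*} (X : ℤ → Ω → ℝ) (M : ℝ) (n : ℕ) {p : ℕ} (φ : Fin p → ℝ)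
    (ω : Ω) : ℝ :=
  (1 / (n : ℝ)) * ∑ t ∈ Finset.Icc 1 n,
    truncLoss M (X ((t : ℤ) + 1) ω) (arForecast φ (fun s => X s ω) (t : ℤ))

/-- `(∑_{i ∈ I} X_i²)^{1/2}`, where `I = {⌊m/2⌋ + 2mk : 0 ≤ k < μ}` has one index for each
of the `μ` blocks. -/
def subsampleNorm {Ω : Type*} (X : ℤ → Ω → ℝ) (μ m : ℕ) (ω : Ω) : ℝ :=
  Real.sqrt (∑ k ∈ Finset.range μ, X ((m / 2 + 2 * m * k : ℕ) : ℤ) ω ^ 2)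

end ARRisk

end

namespace ARRisk

/-! After division of the observations by `√M`, the loss is `M` times a loss with values in `[0,
1]`. The training error is the average over two interlaced families of `μ` blocks; a block has `m`
loss terms, hence `m + 1` observations, and consecutive blocks of one family are `m` time units
apart. `map_sum_blocks_le` replaces the blocks of a family by independent ones at cost `(μ - 1)
β(m)`. If the risk exceeds the training error by some amount, it exceeds the average over one of the
families by that amount, so a union bound over the two families suffices.

For independent blocks, the largest deviation over a grid of coefficients in `[-1, 1]` is handled
without Rademacher variables. Its fluctuation around its mean is sub-Gaussian (`gridMax_tail_le`),
with variance proxy `1/4` or, when all risks are at most `r ≤ 1/2`, `r (1 - r)`. Its mean is bounded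
by summing increments along the one-dimensional grid (`integral_gridMax_le`): the squared increments
of the truncated loss add up to `O(mesh · |x|)` (`sum_sq_truncLoss_sub_le`), so Cauchy–Schwarz gives
`√(4a / (3μ))`, where `a` bounds the mean absolute normalised observation, whatever the mesh.
Continuity in the coefficient removes the grid (`measure_exists_coeff_le`).

It remains to compare `√a` with the norm terms of the two assertions. In (2) the norm term is at
least `2√2 a / √μ` after normalisation. This dominates the mean deviation when `a ≥ 1/6`; for
smaller `a` the risk is at most `2a`, and the smaller variance proxy makes up the difference
(`exists_variance_factor`). No moment is available in (1), so observations above a quantile `T` are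
discarded, at cost `2L/μ` in risk, where `L` is the logarithm in the bound. Then `a` is the root of
the truncated second moment, and a lower-tail estimate bounds the empirical norm below by `0.4 a`
times its scale (`measure_sum_min_sq_lt_le`). The factor `3` in the confidence term absorbs the
losses. -/

/-- The law of the sum of `n` independent variables of law `ν`. -/
noncomputable def iterConv {E : Type*} [AddMonoid E] [MeasurableSpace E] (ν : Measure E) :
    ℕ → Measure E
  | 0 => Measure.dirac 0
  | n + 1 => (ν.prod (iterConv ν n)).map (fun p => p.1 + p.2)

/-! ### Sums of independent variables as iterated convolutions. -/

section iterConv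

variable {E : Type*} [AddMonoid E] [MeasurableSpace E] [MeasurableAdd₂ E]

instance isProbabilityMeasure_iterConv (ν : Measure E) [IsProbabilityMeasure ν] (n : ℕ) :
    IsProbabilityMeasure (iterConv ν n) := by
  induction n with
  | zero => exact Measure.dirac.isProbabilityMeasure
  | succ n ih => exact Measure.isProbabilityMeasure_map measurable_add.aemeasurable

theorem ae_iterConv_succ {ν : Measure E} [IsProbabilityMeasure ν] {n : ℕ} {p q r : E → Prop}
    (hp : ∀ᵐ y ∂ν, p y) (hq : ∀ᵐ x ∂iterConv ν n, q x) (hr : MeasurableSet {x | r x})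
    (h : ∀ y x, p y → q x → r (y + x)) : ∀ᵐ x ∂iterConv ν (n + 1), r x := by
  rw [iterConv, ae_map_iff measurable_add.aemeasurable hr]
  have h1 := Measure.quasiMeasurePreserving_fst (μ := ν) (ν := iterConv ν n) |>.ae hp
  have h2 := Measure.quasiMeasurePreserving_snd (μ := ν) (ν := iterConv ν n) |>.ae hq
  filter_upwards [h1, h2] with z hz1 hz2 using h _ _ hz1 hz2

theorem integral_iterConv_succ {ν : Measure E} [IsProbabilityMeasure ν] {n : ℕ} {f : E → ℝ}
    (hf : Measurable f) (hi : Integrable f (iterConv ν (n + 1))) :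
    ∫ x, f x ∂iterConv ν (n + 1) = ∫ y, ∫ x, f (y + x) ∂iterConv ν n ∂ν := by
  rw [iterConv, integral_map measurable_add.aemeasurable hf.aestronglyMeasurable]
  rw [iterConv, integrable_map_measure hf.aestronglyMeasurable measurable_add.aemeasurable] at hi
  exact integral_prod _ hi

theorem integrable_iterConv_succ {ν : Measure E} [IsProbabilityMeasure ν] {n : ℕ} {f : E → ℝ}
    (hf : Measurable f) (hi : Integrable f (iterConv ν (n + 1))) :
    Integrable (fun p : E × E => f (p.1 + p.2)) (ν.prod (iterConv ν n)) := by
  rwa [iterConv, integrable_map_measure hf.aestronglyMeasurable measurable_add.aemeasurable] at hi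

end iterConv

/-! ### Exponential moments of `[0, 1]`-valued variables. -/

/-- This is `tanh (l / 2) ≤ l / 2`, cleared of denominators. -/
theorem one_sub_exp_neg_le {l : ℝ} (hl : 0 ≤ l) :
    1 - Real.exp (-l) ≤ l * (1 + Real.exp (-l)) / 2 := by
  have hd : ∀ x : ℝ, HasDerivAt
      (fun x : ℝ => x * (1 + Real.exp (-x)) / 2 - (1 - Real.exp (-x)))
      ((1 - (1 + x) * Real.exp (-x)) / 2) x := by
    intro x
    have h1 : HasDerivAt (fun x : ℝ => Real.exp (-x)) (Real.exp (-x) * (-1)) x :=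
      (hasDerivAt_neg x).exp
    have h2 := (((hasDerivAt_id x).mul (h1.const_add 1)).div_const 2).sub (h1.const_sub 1)
    refine h2.congr_deriv ?_
    simp only [id]; ring
  have hm : MonotoneOn (fun x : ℝ => x * (1 + Real.exp (-x)) / 2 - (1 - Real.exp (-x)))
      (Set.Ici 0) := by
    apply monotoneOn_of_deriv_nonneg (convex_Ici 0)
    · exact fun x _ => (hd x).continuousAt.continuousWithinAt
    · exact fun x _ => (hd x).differentiableAt.differentiableWithinAt
    · intro x hx
      rw [(hd x).deriv]
      have h1 := Real.add_one_le_exp x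
      have h2 : Real.exp x * Real.exp (-x) = 1 := by rw [← Real.exp_add]; simp
      have h3 := Real.exp_pos (-x)
      nlinarith
  have := hm (Set.mem_Ici.2 le_rfl) (Set.mem_Ici.2 hl) hl
  simp at this
  linarith

/-- Sub-Gaussian bound for the lower tail of a Bernoulli variable of small mean. -/
theorem bernoulli_lower_mgf_le {q l : ℝ} (hq0 : 0 ≤ q) (hq : q ≤ 1 / 2) (hl : 0 ≤ l) :
    1 - q + q * Real.exp (-l) ≤ Real.exp (-(l * q) + l ^ 2 * (q * (1 - q)) / 2) := by
  have hd : ∀ x : ℝ, HasDerivAt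
      (fun x : ℝ => Real.exp (x * q - x ^ 2 * (q * (1 - q)) / 2) * (1 - q + q * Real.exp (-x)))
      (Real.exp (x * q - x ^ 2 * (q * (1 - q)) / 2) *
        (q * (1 - q) * ((1 - Real.exp (-x)) - x * (1 - q + q * Real.exp (-x))))) x := by
    intro x
    have h1 : HasDerivAt (fun x : ℝ => Real.exp (-x)) (Real.exp (-x) * (-1)) x :=
      (hasDerivAt_neg x).exp
    have h2 : HasDerivAt (fun x : ℝ => x * q - x ^ 2 * (q * (1 - q)) / 2)
        (1 * q - 2 * x * (q * (1 - q)) / 2) x := by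
      refine (((hasDerivAt_id x).mul_const q).sub
        ((((hasDerivAt_pow 2 x)).mul_const (q * (1 - q))).div_const 2)).congr_deriv ?_
      simp
    refine (h2.exp.mul ((h1.const_mul q).const_add (1 - q))).congr_deriv ?_
    ring
  have hm : AntitoneOn
      (fun x : ℝ => Real.exp (x * q - x ^ 2 * (q * (1 - q)) / 2) * (1 - q + q * Real.exp (-x)))
      (Set.Ici 0) := by
    apply antitoneOn_of_deriv_nonpos (convex_Ici 0)
    · exact fun x _ => (hd x).continuousAt.continuousWithinAt
    · exact fun x _ => (hd x).differentiableAt.differentiableWithinAt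
    · intro x hx
      rw [interior_Ici] at hx
      have hx0 : 0 ≤ x := le_of_lt hx
      rw [(hd x).deriv]
      have h1 := one_sub_exp_neg_le hx0
      have h2 : Real.exp (-x) ≤ 1 := Real.exp_le_one_iff.2 (by linarith)
      -- Only here does `q ≤ 1/2` enter: the weighted mean of `1` and `exp (-x)` leans towards `1`.
      -- With `h1` it fixes the sign of the derivative.
      have h3 : (1 + Real.exp (-x)) / 2 ≤ 1 - q + q * Real.exp (-x) := by nlinarith
      have h4 := mul_le_mul_of_nonneg_left h3 hx0
      apply mul_nonpos_of_nonneg_of_nonpos (Real.exp_pos _).le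
      apply mul_nonpos_of_nonneg_of_nonpos (mul_nonneg hq0 (by linarith))
      linarith
  have h := hm (Set.mem_Ici.2 le_rfl) (Set.mem_Ici.2 hl) hl
  simp only [zero_mul, neg_zero, Real.exp_zero] at h
  norm_num at h
  have h5 : Real.exp (-(l * q) + l ^ 2 * (q * (1 - q)) / 2)
      * Real.exp (l * q - l ^ 2 * (q * (1 - q)) / 2) = 1 := by
    rw [← Real.exp_add]; simp
  have h6 := Real.exp_pos (-(l * q) + l ^ 2 * (q * (1 - q)) / 2)
  calc 1 - q + q * Real.exp (-l)
      = Real.exp (-(l * q) + l ^ 2 * (q * (1 - q)) / 2) *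
        (Real.exp (l * q - l ^ 2 * (q * (1 - q)) / 2) * (1 - q + q * Real.exp (-l))) := by
        rw [← mul_assoc, h5, one_mul]
    _ ≤ _ := by nlinarith

theorem exp_neg_mul_le_chord {w l : ℝ} (h0 : 0 ≤ w) (h1 : w ≤ 1) :
    Real.exp (-(l * w)) ≤ 1 - w + w * Real.exp (-l) := by
  have := convexOn_exp.2 (Set.mem_univ 0) (Set.mem_univ (-l)) (sub_nonneg.2 h1) h0 (by ring)
  simp at this
  rw [show -(l * w) = -(w * l) by ring]
  linarith

section mgf

variable {S : Type*} [MeasurableSpace S] {ν : Measure S} [IsProbabilityMeasure ν] {w : S → ℝ}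

theorem integrable_of_unit (hw : AEMeasurable w ν) (h01 : ∀ᵐ y ∂ν, w y ∈ Set.Icc (0 : ℝ) 1) :
    Integrable w ν :=
  Integrable.of_mem_Icc 0 1 hw h01

theorem integral_exp_neg_le_chord (hw : AEMeasurable w ν)
    (h01 : ∀ᵐ y ∂ν, w y ∈ Set.Icc (0 : ℝ) 1) {l : ℝ} (hl : 0 ≤ l) :
    ∫ y, Real.exp (-(l * w y)) ∂ν ≤ 1 - ∫ y, w y ∂ν + (∫ y, w y ∂ν) * Real.exp (-l) := by
  have hi := integrable_of_unit hw h01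
  have h2 : ∫ y, (1 - w y + w y * Real.exp (-l)) ∂ν
      = 1 - ∫ y, w y ∂ν + (∫ y, w y ∂ν) * Real.exp (-l) := by
    have hi1 : Integrable (fun y => 1 - w y) ν := (integrable_const _).sub hi
    rw [integral_add hi1 (hi.mul_const _), integral_sub (integrable_const _) hi,
      integral_mul_const]
    simp
  rw [← h2]
  apply integral_mono_ae
  · apply Integrable.of_mem_Icc 0 1
    · exact ((hw.const_mul l).neg).exp
    · filter_upwards [h01] with y hy
      exact ⟨(Real.exp_pos _).le, Real.exp_le_one_iff.2 (by nlinarith [mul_nonneg hl hy.1])⟩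
  · exact ((integrable_const _).sub hi).add (hi.mul_const _)
  · filter_upwards [h01] with y hy using exp_neg_mul_le_chord hy.1 hy.2

/-- The first alternative is Hoeffding's lemma. In the second, convexity reduces to a Bernoulli
variable of the same mean, and `q (1 - q)` is increasing for `q ≤ 1/2`, so a bound on the mean
bounds the variance proxy. -/
theorem lower_mgf_le (hw : AEMeasurable w ν) (h01 : ∀ᵐ y ∂ν, w y ∈ Set.Icc (0 : ℝ) 1)
    {r v l : ℝ} (hr : ∫ y, w y ∂ν ≤ r) (hv : 1 / 4 ≤ v ∨ (r ≤ 1 / 2 ∧ r * (1 - r) ≤ v))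
    (hl : 0 ≤ l) :
    ∫ y, Real.exp (-(l * w y)) ∂ν ≤ Real.exp (-(l * ∫ y, w y ∂ν) + l ^ 2 * v / 2) := by
  have hq0 : 0 ≤ ∫ y, w y ∂ν := integral_nonneg_of_ae (by
    filter_upwards [h01] with y hy using hy.1)
  rcases hv with hv | ⟨hr2, hv⟩
  · have h := (ProbabilityTheory.hasSubgaussianMGF_of_mem_Icc hw h01).mgf_le (-l)
    simp only [ProbabilityTheory.mgf] at h
    have h3 : ∀ y, Real.exp (-l * (w y - ∫ y, w y ∂ν))
        = Real.exp (-(l * w y)) * Real.exp (l * ∫ y, w y ∂ν) := by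
      intro y; rw [← Real.exp_add]; congr 1; ring
    simp only [h3, integral_mul_const] at h
    norm_num at h
    have h4 : Real.exp (l * ∫ y, w y ∂ν) * Real.exp (-(l * ∫ y, w y ∂ν)) = 1 := by
      rw [← Real.exp_add]; simp
    calc ∫ y, Real.exp (-(l * w y)) ∂ν
        = (∫ y, Real.exp (-(l * w y)) ∂ν) * Real.exp (l * ∫ y, w y ∂ν)
          * Real.exp (-(l * ∫ y, w y ∂ν)) := by rw [mul_assoc, h4, mul_one]
      _ ≤ Real.exp ((1 / 2) ^ 2 * l ^ 2 / 2) * Real.exp (-(l * ∫ y, w y ∂ν)) := by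
          refine mul_le_mul_of_nonneg_right ?_ (Real.exp_pos _).le
          exact h.trans_eq (by norm_num)
      _ ≤ _ := by
          rw [← Real.exp_add]
          apply Real.exp_le_exp.2
          nlinarith [sq_nonneg l]
  · refine (integral_exp_neg_le_chord hw h01 hl).trans
      ((bernoulli_lower_mgf_le hq0 (hr.trans hr2) hl).trans ?_)
    apply Real.exp_le_exp.2
    have : (∫ y, w y ∂ν) * (1 - ∫ y, w y ∂ν) ≤ v := by nlinarith
    nlinarith [sq_nonneg l]

end mgf

/-! ### First and second moments of sums of independent variables. -/

section moments

variable {E : Type*} [AddMonoid E] [MeasurableSpace E] [MeasurableAdd₂ E]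
  {ν : Measure E} [IsProbabilityMeasure ν] {L : E →+ ℝ}

theorem ae_abs_le_iterConv (hL : Measurable L) (hb : ∀ᵐ y ∂ν, |L y| ≤ 1) (n : ℕ) :
    ∀ᵐ x ∂iterConv ν n, |L x| ≤ n := by
  induction n with
  | zero =>
    rw [iterConv, ae_dirac_iff (measurableSet_le hL.abs measurable_const)]
    simp
  | succ n ih =>
    refine ae_iterConv_succ hb ih (measurableSet_le hL.abs measurable_const) ?_
    intro y x hy hx
    rw [map_add]
    push_cast
    linarith [abs_add_le (L y) (L x)]

theorem integrable_iterConv (hL : Measurable L) (hb : ∀ᵐ y ∂ν, |L y| ≤ 1) (n : ℕ) :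
    Integrable L (iterConv ν n) :=
  Integrable.of_bound hL.aestronglyMeasurable n (ae_abs_le_iterConv hL hb n)

theorem integral_iterConv (hL : Measurable L) (hb : ∀ᵐ y ∂ν, |L y| ≤ 1) (n : ℕ) :
    ∫ x, L x ∂iterConv ν n = n * ∫ y, L y ∂ν := by
  induction n with
  | zero => rw [iterConv, integral_dirac' _ _ hL.stronglyMeasurable]; simp
  | succ n ih =>
    have hi := integrable_iterConv hL hb n
    have hi1 : Integrable L ν := Integrable.of_bound hL.aestronglyMeasurable 1 hb
    rw [integral_iterConv_succ hL (integrable_iterConv hL hb _)]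
    have h : ∀ y, ∫ x, L (y + x) ∂iterConv ν n = L y + n * ∫ y, L y ∂ν := by
      intro y
      simp only [map_add]
      rw [integral_add (integrable_const _) hi, ih]
      simp
    simp only [h]
    rw [integral_add hi1 (integrable_const _)]
    simp
    ring

/-- Variances add because the cross term has mean zero; each summand's variance is then bounded by
its second moment. -/
theorem integral_sq_iterConv_le (hL : Measurable L) (hb : ∀ᵐ y ∂ν, |L y| ≤ 1) (n : ℕ) :
    ∫ x, (L x - n * ∫ y, L y ∂ν) ^ 2 ∂iterConv ν n ≤ n * ∫ y, L y ^ 2 ∂ν := by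
  set d := ∫ y, L y ∂ν with hd
  have hi1 : Integrable L ν := Integrable.of_bound hL.aestronglyMeasurable 1 hb
  have hi2 : Integrable (fun y => L y ^ 2) ν := by
    refine Integrable.of_bound (hL.pow_const 2).aestronglyMeasurable 1 ?_
    filter_upwards [hb] with y hy
    rw [Real.norm_eq_abs, abs_pow]
    exact pow_le_one₀ (abs_nonneg _) hy
  have hint : ∀ n : ℕ, Integrable (fun x => (L x - n * d) ^ 2) (iterConv ν n) := by
    intro n
    refine Integrable.of_bound ((hL.sub_const _).pow_const 2).aestronglyMeasurable
      ((n + |n * d|) ^ 2) ?_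
    filter_upwards [ae_abs_le_iterConv hL hb n] with x hx
    rw [Real.norm_eq_abs, abs_pow]
    exact pow_le_pow_left₀ (abs_nonneg _) ((abs_sub _ _).trans (by linarith)) 2
  induction n with
  | zero =>
    rw [iterConv, integral_dirac' _ _ ((hL.sub_const _).pow_const 2).stronglyMeasurable]
    simp
  | succ n ih =>
    have hi := integrable_iterConv hL hb n
    rw [integral_iterConv_succ ((hL.sub_const _).pow_const 2) (hint (n + 1))]
    set V := ∫ x, (L x - n * d) ^ 2 ∂iterConv ν n with hV
    have h : ∀ y, ∫ x, (L (y + x) - ((n + 1 : ℕ) : ℝ) * d) ^ 2 ∂iterConv ν n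
        = (L y - d) ^ 2 + V := by
      intro y
      have h0 : ∀ x, (L (y + x) - ((n + 1 : ℕ) : ℝ) * d) ^ 2
          = (L y - d) ^ 2 + 2 * (L y - d) * (L x - n * d) + (L x - n * d) ^ 2 := by
        intro x; rw [map_add]; push_cast; ring
      simp only [h0]
      have hs : Integrable (fun x => L x - n * d) (iterConv ν n) := hi.sub (integrable_const _)
      have hs2 : Integrable (fun x => (L y - d) ^ 2 + 2 * (L y - d) * (L x - n * d))
        (iterConv ν n) := (integrable_const _).add (hs.const_mul _)
      rw [integral_add hs2 (hint n), integral_add (integrable_const _) (hs.const_mul _),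
        integral_const_mul, integral_sub hi (integrable_const _), integral_iterConv hL hb n]
      simp [← hd, ← hV]
    simp only [h]
    have h1 : ∫ y, ((L y - d) ^ 2 + V) ∂ν = ∫ y, L y ^ 2 ∂ν - d ^ 2 + V := by
      have h0 : ∀ y, (L y - d) ^ 2 + V = L y ^ 2 - (2 * d) * L y + (d ^ 2 + V) := by
        intro y; ring
      simp only [h0]
      have hs2 : Integrable (fun y => L y ^ 2 - (2 * d) * L y) ν := hi2.sub (hi1.const_mul _)
      rw [integral_add hs2 (integrable_const _), integral_sub hi2 (hi1.const_mul _),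
        integral_const_mul, ← hd]
      simp; ring
    rw [h1]
    push_cast
    nlinarith [sq_nonneg d]

theorem integral_abs_iterConv_le (hL : Measurable L) (hb : ∀ᵐ y ∂ν, |L y| ≤ 1) (n : ℕ) :
    ∫ x, |L x - n * ∫ y, L y ∂ν| ∂iterConv ν n ≤ Real.sqrt (n * ∫ y, L y ^ 2 ∂ν) := by
  refine le_trans ?_ (Real.sqrt_le_sqrt (integral_sq_iterConv_le hL hb n))
  apply Real.le_sqrt_of_sq_le
  set d := ∫ y, L y ∂ν
  have hbd : ∀ᵐ x ∂iterConv ν n, |L x - n * d| ≤ n + |n * d| := by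
    filter_upwards [ae_abs_le_iterConv hL hb n] with x hx
    exact (abs_sub _ _).trans (by linarith)
  have hm : MemLp (fun x => |L x - n * d|) 2 (iterConv ν n) := by
    refine MemLp.of_bound (hL.sub_const _).abs.aestronglyMeasurable (n + |n * d|) ?_
    filter_upwards [hbd] with x hx
    simpa using hx
  have h := ProbabilityTheory.variance_nonneg (fun x => |L x - n * d|) (iterConv ν n)
  rw [ProbabilityTheory.variance_eq_sub hm] at h
  simpa [sq_abs] using h

end moments

/-! ### Maxima over a finite grid. -/

/-- The maximum of `c i - s i` over `i ≤ N`. -/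
noncomputable def gridMax (N : ℕ) (c s : ℕ → ℝ) : ℝ :=
  (Finset.range (N + 1)).sup' Finset.nonempty_range_add_one (fun i => c i - s i)

theorem le_gridMax {N i : ℕ} (hi : i ≤ N) (c s : ℕ → ℝ) : c i - s i ≤ gridMax N c s :=
  Finset.le_sup' (fun i => c i - s i) (Finset.mem_range.2 (by omega))

theorem gridMax_le {N : ℕ} {c s : ℕ → ℝ} {b : ℝ} (h : ∀ i ≤ N, c i - s i ≤ b) :
    gridMax N c s ≤ b :=
  Finset.sup'_le _ _ fun i hi => h i (by have := Finset.mem_range.1 hi; omega)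

theorem exists_eq_gridMax (N : ℕ) (c s : ℕ → ℝ) : ∃ i ≤ N, gridMax N c s = c i - s i := by
  obtain ⟨i, hi, h⟩ := Finset.exists_mem_eq_sup' (s := Finset.range (N + 1))
    Finset.nonempty_range_add_one (fun i => c i - s i)
  exact ⟨i, by have := Finset.mem_range.1 hi; omega, h⟩

theorem measurable_gridMax (N : ℕ) :
    Measurable fun p : (ℕ → ℝ) × (ℕ → ℝ) => gridMax N p.1 p.2 := by
  unfold gridMax
  exact Finset.measurable_range_sup'' fun i _ =>
    ((measurable_pi_apply i).comp measurable_fst).sub ((measurable_pi_apply i).comp measurable_snd)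

theorem gridMax_add (N : ℕ) (c y x : ℕ → ℝ) : gridMax N c (y + x) = gridMax N (c - y) x := by
  unfold gridMax
  congr 1
  ext i
  simp; ring

theorem gridMax_mem_Icc {N : ℕ} {c s : ℕ → ℝ} {b : ℝ} (hs : ∀ i, s i ∈ Set.Icc 0 b) :
    gridMax N c s ∈ Set.Icc (c 0 - b) (gridMax N c 0) := by
  constructor
  · exact le_trans (by linarith [(hs 0).2]) (le_gridMax (Nat.zero_le N) c s)
  · refine gridMax_le fun i hi => le_trans ?_ (le_gridMax hi c 0)
    simp [(hs i).1]

theorem gridMax_sub_mem_Icc {N : ℕ} {c x y : ℕ → ℝ} (hy : ∀ i, y i ∈ Set.Icc (0 : ℝ) 1) :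
    gridMax N c x - gridMax N c (y + x) ∈ Set.Icc (0 : ℝ) 1 := by
  constructor
  · rw [sub_nonneg]
    refine gridMax_le fun i hi => le_trans ?_ (le_gridMax hi c x)
    simp [(hy i).1]
  · rw [sub_le_iff_le_add]
    refine gridMax_le fun i hi => ?_
    have := le_gridMax hi c (y + x)
    simp at this
    linarith [(hy i).2]

/-- The index attaining the maximum at `x` serves for every `y`. Integrating over `y`, the mean
decrease of the maximum is at most the mean of one coordinate, hence at most the largest risk. -/
theorem exists_gridMax_sub_le (N : ℕ) (c x : ℕ → ℝ) :
    ∃ i ≤ N, ∀ y, gridMax N c x - gridMax N c (y + x) ≤ y i := by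
  obtain ⟨i, hi, h⟩ := exists_eq_gridMax N c x
  refine ⟨i, hi, fun y => ?_⟩
  have := le_gridMax hi c (y + x)
  simp at this
  linarith

/-! ### Concentration and mean of the largest deviation. -/

section concentration

variable {ν : Measure (ℕ → ℝ)} [IsProbabilityMeasure ν]

theorem ae_mem_Icc_iterConv (hν : ∀ᵐ y ∂ν, ∀ i, y i ∈ Set.Icc (0 : ℝ) 1) (n : ℕ) :
    ∀ᵐ x ∂iterConv ν n, ∀ i, x i ∈ Set.Icc (0 : ℝ) n := by
  have hm : ∀ b : ℝ, MeasurableSet {x : ℕ → ℝ | ∀ i, x i ∈ Set.Icc (0 : ℝ) b} := by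
    intro b
    rw [Set.ofPred_forall]
    exact MeasurableSet.iInter fun i => measurable_pi_apply i measurableSet_Icc
  induction n with
  | zero =>
    rw [iterConv, ae_dirac_iff (hm _)]
    simp
  | succ n ih =>
    refine ae_iterConv_succ hν ih (hm _) ?_
    intro y x hy hx i
    have h1 := hy i
    have h2 := hx i
    simp only [Set.mem_Icc, Pi.add_apply] at *
    push_cast
    exact ⟨by linarith, by linarith⟩

theorem integrable_gridMax (hν : ∀ᵐ y ∂ν, ∀ i, y i ∈ Set.Icc (0 : ℝ) 1) (n N : ℕ) (c : ℕ → ℝ) :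
    Integrable (gridMax N c) (iterConv ν n) := by
  refine Integrable.of_mem_Icc (c 0 - n) (gridMax N c 0)
    ((measurable_gridMax N).comp measurable_prodMk_left).aemeasurable ?_
  filter_upwards [ae_mem_Icc_iterConv hν n] with x hx using gridMax_mem_Icc hx

/-- Summands are revealed one at a time. Adding `y` lowers the conditional mean of the maximum by `w
y ∈ [0, 1]`, whose mean is at most `r`; so an upper deviation of the maximum is a lower deviation of
`w`, to which `lower_mgf_le` applies. The induction runs over all offsets `c`, since adding `y`
amounts to replacing `c` by `c - y`. -/
theorem gridMax_mgf_le (hν : ∀ᵐ y ∂ν, ∀ i, y i ∈ Set.Icc (0 : ℝ) 1) {N : ℕ} {r v l : ℝ}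
    (hr : ∀ i ≤ N, ∫ y, y i ∂ν ≤ r) (hv : 1 / 4 ≤ v ∨ (r ≤ 1 / 2 ∧ r * (1 - r) ≤ v))
    (hl : 0 ≤ l) (n : ℕ) (c : ℕ → ℝ) :
    ∫ x, Real.exp (l * gridMax N c x) ∂iterConv ν n ≤
      Real.exp (l * ∫ x, gridMax N c x ∂iterConv ν n + n * (l ^ 2 * v / 2)) := by
  have hmc : ∀ c : ℕ → ℝ, Measurable (gridMax N c) := fun c =>
    (measurable_gridMax N).comp measurable_prodMk_left
  have hexp : ∀ (n : ℕ) (c : ℕ → ℝ),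
      Integrable (fun x => Real.exp (l * gridMax N c x)) (iterConv ν n) := by
    intro n c
    refine Integrable.of_mem_Icc 0 (Real.exp (l * gridMax N c 0))
      ((hmc c).const_mul l).exp.aemeasurable ?_
    filter_upwards [ae_mem_Icc_iterConv hν n] with x hx
    exact ⟨(Real.exp_pos _).le,
      Real.exp_le_exp.2 (mul_le_mul_of_nonneg_left (gridMax_mem_Icc hx).2 hl)⟩
  induction n generalizing c with
  | zero =>
    rw [iterConv, integral_dirac' _ _ (hmc c).stronglyMeasurable,
      integral_dirac' _ _ ((hmc c).const_mul l).exp.stronglyMeasurable]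
    simp
  | succ n ih =>
    have hF := integrable_iterConv_succ (hmc c) (integrable_gridMax hν (n + 1) N c)
    have hE := integrable_iterConv_succ ((hmc c).const_mul l).exp (hexp (n + 1) c)
    rw [integral_iterConv_succ ((hmc c).const_mul l).exp (hexp (n + 1) c),
      integral_iterConv_succ (hmc c) (integrable_gridMax hν (n + 1) N c)]
    set m0 := ∫ x, gridMax N c x ∂iterConv ν n with hm0
    have hiC := integrable_gridMax hν n N c
    have hiY : ∀ y, Integrable (fun x => gridMax N c (y + x)) (iterConv ν n) := by
      intro y
      simp only [gridMax_add]
      exact integrable_gridMax hν n N _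
    set w : (ℕ → ℝ) → ℝ := fun y => ∫ x, (gridMax N c x - gridMax N c (y + x)) ∂iterConv ν n
      with hw
    have hweq : ∀ y, ∫ x, gridMax N c (y + x) ∂iterConv ν n = m0 - w y := by
      intro y
      rw [hw]
      simp only
      rw [integral_sub hiC (hiY y)]
      ring
    have hG : Integrable (fun p : (ℕ → ℝ) × (ℕ → ℝ) => gridMax N c p.2 - gridMax N c (p.1 + p.2))
        (ν.prod (iterConv ν n)) := (hiC.comp_snd ν).sub hF
    have hwm : AEMeasurable w ν := hG.integral_prod_left.aemeasurable
    have hw01 : ∀ᵐ y ∂ν, w y ∈ Set.Icc (0 : ℝ) 1 := by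
      filter_upwards [hν] with y hy
      constructor
      · exact integral_nonneg fun x => (gridMax_sub_mem_Icc hy).1
      · have : w y ≤ ∫ _x, (1 : ℝ) ∂iterConv ν n :=
          integral_mono (hiC.sub (hiY y)) (integrable_const _) fun x => (gridMax_sub_mem_Icc hy).2
        simpa using this
    have hwr : ∫ y, w y ∂ν ≤ r := by
      rw [hw, integral_integral_swap hG]
      have : ∀ x, ∫ y, (gridMax N c x - gridMax N c (y + x)) ∂ν ≤ r := by
        intro x
        obtain ⟨i, hi, h⟩ := exists_gridMax_sub_le N c x
        refine le_trans (integral_mono_of_nonneg ?_ ?_ (Eventually.of_forall h)) (hr i hi)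
        · filter_upwards [hν] with y hy using (gridMax_sub_mem_Icc hy).1
        · exact integrable_of_unit (measurable_pi_apply i).aemeasurable
            (by filter_upwards [hν] with y hy using hy i)
      refine le_trans (integral_mono hG.integral_prod_right (integrable_const r) this) ?_
      simp
    have hwint := integrable_of_unit hwm hw01
    have hsum : ∫ y, ∫ x, gridMax N c (y + x) ∂iterConv ν n ∂ν = m0 - ∫ y, w y ∂ν := by
      simp only [hweq]
      rw [integral_sub (integrable_const _) hwint]
      simp
    have hstep : ∀ y, ∫ x, Real.exp (l * gridMax N c (y + x)) ∂iterConv ν n ≤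
        Real.exp (l * m0 + n * (l ^ 2 * v / 2)) * Real.exp (-(l * w y)) := by
      intro y
      have h1 := ih (c - y)
      simp only [← gridMax_add] at h1
      rw [hweq y] at h1
      rw [← Real.exp_add]
      refine h1.trans_eq ?_
      congr 1; ring
    have hexpw : Integrable (fun y => Real.exp (-(l * w y))) ν := by
      refine Integrable.of_mem_Icc 0 1 (hwm.const_mul l).neg.exp ?_
      filter_upwards [hw01] with y hy
      exact ⟨(Real.exp_pos _).le, Real.exp_le_one_iff.2 (by nlinarith [mul_nonneg hl hy.1])⟩
    calc ∫ y, ∫ x, Real.exp (l * gridMax N c (y + x)) ∂iterConv ν n ∂ν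
        ≤ ∫ y, Real.exp (l * m0 + n * (l ^ 2 * v / 2)) * Real.exp (-(l * w y)) ∂ν :=
          integral_mono hE.integral_prod_left (hexpw.const_mul _) hstep
      _ = Real.exp (l * m0 + n * (l ^ 2 * v / 2)) * ∫ y, Real.exp (-(l * w y)) ∂ν :=
          integral_const_mul _ _
      _ ≤ Real.exp (l * m0 + n * (l ^ 2 * v / 2)) *
          Real.exp (-(l * ∫ y, w y ∂ν) + l ^ 2 * v / 2) :=
          mul_le_mul_of_nonneg_left (lower_mgf_le hwm hw01 hwr hv hl) (Real.exp_pos _).le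
      _ = _ := by
          rw [hsum, ← Real.exp_add]
          congr 1
          push_cast
          ring

theorem gridMax_tail_le (hν : ∀ᵐ y ∂ν, ∀ i, y i ∈ Set.Icc (0 : ℝ) 1) {N : ℕ} {r v : ℝ}
    (hr : ∀ i ≤ N, ∫ y, y i ∂ν ≤ r) (hv : 1 / 4 ≤ v ∨ (r ≤ 1 / 2 ∧ r * (1 - r) ≤ v))
    (hv0 : 0 < v) {n : ℕ} (hn : 0 < n) (c : ℕ → ℝ) {b t : ℝ} (ht : 0 ≤ t)
    (hb : ∫ x, gridMax N c x ∂iterConv ν n ≤ b) :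
    (iterConv ν n).real {x | b + n * t ≤ gridMax N c x} ≤ Real.exp (-(n * t ^ 2 / (2 * v))) := by
  have hn' : (0 : ℝ) < n := Nat.cast_pos.2 hn
  -- Chernoff's bound is optimised at `l = t / v`.
  have hl : 0 ≤ t / v := div_nonneg ht hv0.le
  have hmc : Measurable (gridMax N c) := (measurable_gridMax N).comp measurable_prodMk_left
  have h := ProbabilityTheory.measure_ge_le_exp_mul_mgf (μ := iterConv ν n) (X := gridMax N c)
    (b + n * t) hl (by
      refine Integrable.of_mem_Icc 0 (Real.exp (t / v * gridMax N c 0))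
        (hmc.const_mul _).exp.aemeasurable ?_
      filter_upwards [ae_mem_Icc_iterConv hν n] with x hx
      exact ⟨(Real.exp_pos _).le,
        Real.exp_le_exp.2 (mul_le_mul_of_nonneg_left (gridMax_mem_Icc hx).2 hl)⟩)
  refine h.trans ((mul_le_mul_of_nonneg_left (gridMax_mgf_le hν hr hv hl n c)
    (Real.exp_pos _).le).trans ?_)
  rw [← Real.exp_add]
  apply Real.exp_le_exp.2
  have h1 := mul_le_mul_of_nonneg_left hb hl
  have h2 : -(t / v) * (n * t) + n * ((t / v) ^ 2 * v / 2) = -(n * t ^ 2 / (2 * v)) := by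
    field_simp
    ring
  nlinarith

/-- The maximum of a finite sequence is at most its middle term plus the increments that go up
when moving away from the middle. -/
theorem gridMax_le_sum (K : ℕ) (d : ℕ → ℝ) :
    gridMax (2 * K) d 0 ≤ d K + ∑ i ∈ Finset.range K, (|d (i + 1) - d i| - (d (i + 1) - d i)) / 2
      + ∑ i ∈ Finset.Ico K (2 * K), (|d (i + 1) - d i| + (d (i + 1) - d i)) / 2 := by
  have hp : ∀ i, 0 ≤ (|d (i + 1) - d i| + (d (i + 1) - d i)) / 2 := fun i => by
    linarith [neg_abs_le (d (i + 1) - d i)]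
  have hq : ∀ i, 0 ≤ (|d (i + 1) - d i| - (d (i + 1) - d i)) / 2 := fun i => by
    linarith [le_abs_self (d (i + 1) - d i)]
  have hup : ∀ j, d (K + j) ≤ d K + ∑ i ∈ Finset.Ico K (K + j),
      (|d (i + 1) - d i| + (d (i + 1) - d i)) / 2 := by
    intro j
    induction j with
    | zero => simp
    | succ j ih =>
      rw [← add_assoc, Finset.sum_Ico_succ_top (by omega)]
      linarith [le_abs_self (d (K + j + 1) - d (K + j))]
  have hdown : ∀ j ≤ K, d (K - j) ≤ d K + ∑ i ∈ Finset.Ico (K - j) K,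
      (|d (i + 1) - d i| - (d (i + 1) - d i)) / 2 := by
    intro j
    induction j with
    | zero => simp
    | succ j ih =>
      intro hj
      have h1 := ih (by omega)
      rw [Finset.sum_eq_sum_Ico_succ_bot (by omega), show K - (j + 1) + 1 = K - j by omega]
      linarith [neg_abs_le (d (K - j) - d (K - (j + 1)))]
  refine gridMax_le fun i hi => ?_
  simp only [Pi.zero_apply, sub_zero]
  rcases le_total i K with h | h
  · have h1 := hdown (K - i) (by omega)
    rw [show K - (K - i) = i by omega] at h1
    have h2 : ∑ i ∈ Finset.Ico i K, (|d (i + 1) - d i| - (d (i + 1) - d i)) / 2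
        ≤ ∑ i ∈ Finset.range K, (|d (i + 1) - d i| - (d (i + 1) - d i)) / 2 := by
      refine Finset.sum_le_sum_of_subset_of_nonneg ?_ fun i _ _ => hq i
      intro a; simp
    linarith [Finset.sum_nonneg fun i (_ : i ∈ Finset.Ico K (2 * K)) => hp i]
  · have h1 := hup (i - K)
    rw [show K + (i - K) = i by omega] at h1
    have h2 : ∑ i ∈ Finset.Ico K i, (|d (i + 1) - d i| + (d (i + 1) - d i)) / 2
        ≤ ∑ i ∈ Finset.Ico K (2 * K), (|d (i + 1) - d i| + (d (i + 1) - d i)) / 2 := by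
      refine Finset.sum_le_sum_of_subset_of_nonneg ?_ fun i _ _ => hp i
      exact Finset.Ico_subset_Ico le_rfl hi
    linarith [Finset.sum_nonneg fun i (_ : i ∈ Finset.range K) => hq i]

/-- Coordinate evaluation. -/
def coordHom (i : ℕ) : (ℕ → ℝ) →+ ℝ := Pi.evalAddMonoidHom (fun _ => ℝ) i

/-- By `gridMax_le_sum` the maximum is at most the centred middle term plus one-sided parts of
centred increments. The middle term has mean zero, and either one-sided part of a centred variable
has half its mean absolute value, at most half the root of its second moment. Cauchy–Schwarz over
the `2K` increments yields the root of `n · 2K · e / 4`. -/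
theorem integral_gridMax_le (hν : ∀ᵐ y ∂ν, ∀ i, y i ∈ Set.Icc (0 : ℝ) 1) (K n : ℕ) {e : ℝ}
    (he : ∑ i ∈ Finset.range (2 * K), ∫ y, (y (i + 1) - y i) ^ 2 ∂ν ≤ e) :
    ∫ x, gridMax (2 * K) (fun i => n * ∫ y, y i ∂ν) x ∂iterConv ν n ≤
      Real.sqrt (n * (K * e / 2)) := by
  set q : ℕ → ℝ := fun i => ∫ y, y i ∂ν with hq
  have hyi : ∀ i, Integrable (fun y : ℕ → ℝ => y i) ν := fun i =>
    integrable_of_unit (measurable_pi_apply i).aemeasurable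
      (by filter_upwards [hν] with y hy using hy i)
  -- increments
  let L : ℕ → (ℕ → ℝ) →+ ℝ := fun i => coordHom (i + 1) - coordHom i
  have hLap : ∀ i x, L i x = x (i + 1) - x i := fun i x => rfl
  have hLm : ∀ i, Measurable (L i) := fun i =>
    (measurable_pi_apply (i + 1)).sub (measurable_pi_apply i)
  have hLb : ∀ i, ∀ᵐ y ∂ν, |L i y| ≤ 1 := by
    intro i
    filter_upwards [hν] with y hy
    have h1 := hy i
    have h2 := hy (i + 1)
    rw [hLap, abs_le]
    exact ⟨by linarith [h1.2, h2.1], by linarith [h1.1, h2.2]⟩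
  have hCm : Measurable (coordHom K) := measurable_pi_apply K
  have hCb : ∀ᵐ y ∂ν, |coordHom K y| ≤ 1 := by
    filter_upwards [hν] with y hy
    have h1 := hy K
    change |y K| ≤ 1
    rw [abs_le]
    exact ⟨by linarith [h1.1], h1.2⟩
  have hLint : ∀ i, ∫ y, L i y ∂ν = q (i + 1) - q i := fun i => integral_sub (hyi _) (hyi _)
  have hiL := fun i => integrable_iterConv (hLm i) (hLb i) n
  have hiLc : ∀ i, Integrable (fun x => L i x - n * ∫ y, L i y ∂ν) (iterConv ν n) := fun i =>
    (hiL i).sub (integrable_const _)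
  have hzero : ∀ i, ∫ x, (L i x - n * ∫ y, L i y ∂ν) ∂iterConv ν n = 0 := by
    intro i
    rw [integral_sub (hiL i) (integrable_const _), integral_iterConv (hLm i) (hLb i)]
    simp
  have hiC := integrable_iterConv hCm hCb n
  have hpt : ∀ x, gridMax (2 * K) (fun i => n * q i) x ≤
      (n * q K - coordHom K x)
      + ∑ i ∈ Finset.range K,
        (|L i x - n * ∫ y, L i y ∂ν| + (L i x - n * ∫ y, L i y ∂ν)) / 2
      + ∑ i ∈ Finset.Ico K (2 * K),
        (|L i x - n * ∫ y, L i y ∂ν| - (L i x - n * ∫ y, L i y ∂ν)) / 2 := by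
    intro x
    have h := gridMax_le_sum K (fun i => n * q i - x i)
    have h0 : gridMax (2 * K) (fun i => n * q i - x i) 0 = gridMax (2 * K) (fun i => n * q i) x := by
      unfold gridMax; simp
    rw [h0] at h
    have h1 : ∀ i, (n * q (i + 1) - x (i + 1)) - (n * q i - x i)
        = -(L i x - n * ∫ y, L i y ∂ν) := by
      intro i; rw [hLint, hLap]; ring
    simp only [h1, abs_neg, sub_neg_eq_add, ← sub_eq_add_neg] at h
    exact h
  have hia : ∀ i, Integrable
      (fun x => (|L i x - n * ∫ y, L i y ∂ν| + (L i x - n * ∫ y, L i y ∂ν)) / 2)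
      (iterConv ν n) := fun i => ((hiLc i).abs.add (hiLc i)).div_const 2
  have his : ∀ i, Integrable
      (fun x => (|L i x - n * ∫ y, L i y ∂ν| - (L i x - n * ∫ y, L i y ∂ν)) / 2)
      (iterConv ν n) := fun i => ((hiLc i).abs.sub (hiLc i)).div_const 2
  have hea : ∀ i, ∫ x, (|L i x - n * ∫ y, L i y ∂ν| + (L i x - n * ∫ y, L i y ∂ν)) / 2
      ∂iterConv ν n = (∫ x, |L i x - n * ∫ y, L i y ∂ν| ∂iterConv ν n) / 2 := by
    intro i
    rw [integral_div, integral_add (hiLc i).abs (hiLc i), hzero, add_zero]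
  have hes : ∀ i, ∫ x, (|L i x - n * ∫ y, L i y ∂ν| - (L i x - n * ∫ y, L i y ∂ν)) / 2
      ∂iterConv ν n = (∫ x, |L i x - n * ∫ y, L i y ∂ν| ∂iterConv ν n) / 2 := by
    intro i
    rw [integral_div, integral_sub (hiLc i).abs (hiLc i), hzero, sub_zero]
  have hi0 : Integrable (fun x => n * q K - coordHom K x) (iterConv ν n) :=
    (integrable_const _).sub hiC
  have hi1 := integrable_finsetSum (Finset.range K) fun i _ => hia i
  have hi2 := integrable_finsetSum (Finset.Ico K (2 * K)) fun i _ => his i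
  have hi01 : Integrable (fun x => (n * q K - coordHom K x) + ∑ i ∈ Finset.range K,
        (|L i x - n * ∫ y, L i y ∂ν| + (L i x - n * ∫ y, L i y ∂ν)) / 2) (iterConv ν n) :=
    hi0.add hi1
  have hmain : ∫ x, gridMax (2 * K) (fun i => n * q i) x ∂iterConv ν n ≤
      ∑ i ∈ Finset.range (2 * K), (∫ x, |L i x - n * ∫ y, L i y ∂ν| ∂iterConv ν n) / 2 := by
    refine (integral_mono (integrable_gridMax hν n _ _) (hi01.add hi2) hpt).trans_eq ?_
    rw [integral_add' hi01 hi2, integral_add hi0 hi1, integral_finsetSum _ fun i _ => hia i,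
      integral_finsetSum _ fun i _ => his i, integral_sub (integrable_const _) hiC,
      integral_iterConv hCm hCb]
    have : ∫ y, coordHom K y ∂ν = q K := rfl
    rw [this]
    simp only [hea, hes]
    rw [← Finset.sum_range_add_sum_Ico _ (show K ≤ 2 * K by omega)]
    simp
  refine hmain.trans ?_
  have hle : ∀ i, (∫ x, |L i x - n * ∫ y, L i y ∂ν| ∂iterConv ν n) / 2 ≤
      Real.sqrt (n * ∫ y, (y (i + 1) - y i) ^ 2 ∂ν) / 2 := by
    intro i
    exact div_le_div_of_nonneg_right (integral_abs_iterConv_le (hLm i) (hLb i) n) zero_le_two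
  refine (Finset.sum_le_sum fun i _ => hle i).trans ?_
  rw [← Finset.sum_div]
  apply Real.le_sqrt_of_sq_le
  have hcs := sq_sum_le_card_mul_sum_sq (s := Finset.range (2 * K))
    (f := fun i => Real.sqrt (n * ∫ y, (y (i + 1) - y i) ^ 2 ∂ν))
  have hsq : ∀ i, Real.sqrt (n * ∫ y, (y (i + 1) - y i) ^ 2 ∂ν) ^ 2
      = n * ∫ y, (y (i + 1) - y i) ^ 2 ∂ν := fun i =>
    Real.sq_sqrt (mul_nonneg (Nat.cast_nonneg n) (integral_nonneg fun y => sq_nonneg _))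
  simp only [hsq, ← Finset.mul_sum, Finset.card_range] at hcs
  push_cast at hcs
  rw [div_pow]
  have : (2 * (K : ℝ) * (n * ∑ i ∈ Finset.range (2 * K), ∫ y, (y (i + 1) - y i) ^ 2 ∂ν))
      ≤ 2 * K * (n * e) := by gcongr
  linarith

end concentration

/-! ### The truncated loss and its quadratic variation in the coefficient. -/

theorem truncLoss_nonneg {M : ℝ} (hM : 0 ≤ M) (y z : ℝ) : 0 ≤ truncLoss M y z :=
  le_min (sq_nonneg _) hM

theorem truncLoss_le (M y z : ℝ) : truncLoss M y z ≤ M := min_le_right _ _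

theorem truncLoss_one_mem_Icc (y z : ℝ) : truncLoss 1 y z ∈ Set.Icc (0 : ℝ) 1 :=
  ⟨truncLoss_nonneg zero_le_one y z, truncLoss_le 1 y z⟩

theorem truncLoss_one_le_abs (y z : ℝ) : truncLoss 1 y z ≤ |y - z| := by
  unfold truncLoss
  rcases le_total |y - z| 1 with h | h
  · refine (min_le_left _ _).trans ?_
    rw [← sq_abs]
    nlinarith [abs_nonneg (y - z)]
  · exact (min_le_right _ _).trans h

theorem truncLoss_eq_mul {M : ℝ} (hM : 0 < M) (y z : ℝ) :
    truncLoss M y z = M * truncLoss 1 (y / Real.sqrt M) (z / Real.sqrt M) := by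
  unfold truncLoss
  rw [← sub_div, div_pow, Real.sq_sqrt hM.le, mul_min_of_nonneg _ _ hM.le, mul_one,
    mul_div_cancel₀ _ hM.ne']

/-- Projection onto `[-1, 1]`. -/
def clampUnit (u : ℝ) : ℝ := max (-1) (min u 1)

theorem min_sq_one_eq_clampUnit_sq (u : ℝ) : min (u ^ 2) 1 = clampUnit u ^ 2 := by
  unfold clampUnit
  rcases le_total u 1 with h1 | h1
  · rcases le_total (-1) u with h2 | h2
    · rw [min_eq_left h1, max_eq_right h2, min_eq_left (by nlinarith)]
    · rw [min_eq_left h1, max_eq_left h2, min_eq_right (by nlinarith)]; norm_num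
  · rw [min_eq_right h1, max_eq_right (by norm_num), min_eq_right (by nlinarith)]; norm_num

theorem clampUnit_mono {u v : ℝ} (h : u ≤ v) : clampUnit u ≤ clampUnit v :=
  max_le_max le_rfl (min_le_min h le_rfl)

theorem clampUnit_sub_le {u v : ℝ} (h : u ≤ v) : clampUnit v - clampUnit u ≤ v - u := by
  unfold clampUnit
  rcases le_total u 1 with h1 | h1 <;> rcases le_total v 1 with h2 | h2 <;>
    rcases le_total (-1) u with h3 | h3 <;> rcases le_total (-1) v with h4 | h4 <;>
    simp [h1, h2, h3, h4] <;> linarith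

theorem clampUnit_mem_Icc (u : ℝ) : clampUnit u ∈ Set.Icc (-1 : ℝ) 1 :=
  ⟨le_max_left _ _, max_le (by norm_num) (min_le_right _ _)⟩

/-- With `a ≤ b` the clamped values, this is Cauchy–Schwarz for `b² - a² = ∫ 2s ds` over `[a, b]`.
Unlike a Lipschitz bound, the right side telescopes along a grid, and the cubes stay in `[-1, 1]`.
-/
theorem sq_sub_min_sq_le {u v : ℝ} (h : u ≤ v) :
    (min (v ^ 2) 1 - min (u ^ 2) 1) ^ 2 ≤
      (v - u) * (4 / 3 * (clampUnit v ^ 3 - clampUnit u ^ 3)) := by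
  rw [min_sq_one_eq_clampUnit_sq, min_sq_one_eq_clampUnit_sq]
  have h1 := clampUnit_mono h
  have h2 := clampUnit_sub_le h
  set a := clampUnit u
  set b := clampUnit v
  have h3 : 0 ≤ 4 / 3 * (b ^ 3 - a ^ 3) := by
    have : b ^ 3 - a ^ 3 = (b - a) * ((a + b) ^ 2 * (3 / 4) + (b - a) ^ 2 / 4) := by ring
    rw [this]
    have := sub_nonneg.2 h1
    positivity
  refine le_trans ?_ (mul_le_mul_of_nonneg_right h2 h3)
  have : (b - a) * (4 / 3 * (b ^ 3 - a ^ 3)) - (b ^ 2 - a ^ 2) ^ 2 = (b - a) ^ 4 / 3 := by ring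
  nlinarith [sq_nonneg ((b - a) ^ 2)]

/-- The quadratic variation of the truncated loss along a regular grid of coefficients. -/
theorem sum_sq_truncLoss_sub_le {p δ : ℝ} (hδ : 0 ≤ δ) (x y : ℝ) (N : ℕ) :
    ∑ i ∈ Finset.range N, (truncLoss 1 y ((p + δ * ((i + 1 : ℕ) : ℝ)) * x)
      - truncLoss 1 y ((p + δ * (i : ℝ)) * x)) ^ 2 ≤ 8 / 3 * δ * |x| := by
  set u : ℕ → ℝ := fun i => y - (p + δ * (i : ℝ)) * x with hu
  have hdiff : ∀ i, u i - u (i + 1) = δ * x := by intro i; simp only [hu]; push_cast; ring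
  change ∑ i ∈ Finset.range N, (min (u (i + 1) ^ 2) 1 - min (u i ^ 2) 1) ^ 2 ≤ _
  have hN := clampUnit_mem_Icc (u N)
  have h0 := clampUnit_mem_Icc (u 0)
  have hc : ∀ c : ℝ, c ∈ Set.Icc (-1 : ℝ) 1 → -1 ≤ c ^ 3 ∧ c ^ 3 ≤ 1 := by
    intro c hc
    have h2 : c ^ 2 ≤ 1 := by nlinarith [hc.1, hc.2]
    constructor <;> nlinarith [hc.1, hc.2, sq_nonneg c]
  have hN3 := hc _ hN
  have h03 := hc _ h0
  rcases le_total 0 x with hx | hx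
  · have hi : ∀ i ∈ Finset.range N, (min (u (i + 1) ^ 2) 1 - min (u i ^ 2) 1) ^ 2 ≤
        δ * x * (4 / 3) * (clampUnit (u i) ^ 3 - clampUnit (u (i + 1)) ^ 3) := by
      intro i _
      have h := sq_sub_min_sq_le (u := u (i + 1)) (v := u i)
        (by linarith [hdiff i, mul_nonneg hδ hx])
      rw [hdiff] at h
      nlinarith
    refine (Finset.sum_le_sum hi).trans ?_
    rw [← Finset.mul_sum, Finset.sum_range_sub' (fun i => clampUnit (u i) ^ 3), abs_of_nonneg hx]
    nlinarith [mul_nonneg hδ hx]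
  · have hx' : 0 ≤ δ * -x := mul_nonneg hδ (by linarith)
    have hi : ∀ i ∈ Finset.range N, (min (u (i + 1) ^ 2) 1 - min (u i ^ 2) 1) ^ 2 ≤
        δ * (-x) * (4 / 3) * (clampUnit (u (i + 1)) ^ 3 - clampUnit (u i) ^ 3) := by
      intro i _
      have h := sq_sub_min_sq_le (u := u i) (v := u (i + 1)) (by linarith [hdiff i])
      rw [show u (i + 1) - u i = δ * (-x) by linarith [hdiff i]] at h
      nlinarith
    refine (Finset.sum_le_sum hi).trans ?_
    rw [← Finset.mul_sum, Finset.sum_range_sub (fun i => clampUnit (u i) ^ 3), abs_of_nonpos hx]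
    nlinarith

/-! ### Stationarity, mixing and the passage to independent blocks. -/

theorem map_block_eq {Ω E : Type*} [MeasurableSpace Ω] [MeasurableSpace E] {P : Measure Ω}
    {X : ℤ → Ω → ℝ} (hX : ∀ t, Measurable (X t)) (hstat : IsStationary P X)
    {q : ℕ} {g : (Fin (q + 1) → ℝ) → E} (hg : Measurable g) (t : ℤ) (j : ℕ) :
    P.map (fun ω => g fun i => X (t + (j : ℤ) + (i : ℤ)) ω) =
      P.map (fun ω => g fun i => X (t + (i : ℤ)) ω) := by
  have h := congrArg (Measure.map g) (hstat t q j)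
  rw [Measure.map_map hg (measurable_pi_lambda _ fun i => hX _),
    Measure.map_map hg (measurable_pi_lambda _ fun i => hX _)] at h
  exact h.symm

section transfer

variable {Ω : Type*} [MeasurableSpace Ω] {P : Measure Ω} [IsProbabilityMeasure P] {X : ℤ → Ω → ℝ}

theorem measurable_past (hX : ∀ t, Measurable (X t)) (t : ℤ) : Measurable (past X t) :=
  measurable_pi_lambda _ fun s => hX s

theorem measurable_future (hX : ∀ t, Measurable (X t)) (t : ℤ) : Measurable (future X t) :=
  measurable_pi_lambda _ fun s => hX s

theorem abs_sub_le_betaCoeff (hX : ∀ t, Measurable (X t)) (t : ℤ) (m : ℕ)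
    {C : Set (({s : ℤ // s ≤ t} → ℝ) × ({s : ℤ // t + (m : ℤ) ≤ s} → ℝ))} (hC : MeasurableSet C) :
    |(P.map (fun ω => (past X t ω, future X (t + (m : ℤ)) ω))).real C -
      ((P.map (past X t)).prod (P.map (future X (t + (m : ℤ))))).real C| ≤ betaCoeff P X m := by
  unfold betaCoeff
  refine le_ciSup (f := fun q : (Σ t : ℤ, {C : Set (({s : ℤ // s ≤ t} → ℝ) ×
      ({s : ℤ // t + (m : ℤ) ≤ s} → ℝ)) // MeasurableSet C}) =>
    |(P.map (fun ω => (past X q.1 ω, future X (q.1 + (m : ℤ)) ω))).real q.2.1 -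
      ((P.map (past X q.1)).prod (P.map (future X (q.1 + (m : ℤ))))).real q.2.1|) ?_
    ⟨t, C, hC⟩
  refine ⟨1, ?_⟩
  rintro _ ⟨q, rfl⟩
  have h1 := Measure.isProbabilityMeasure_map (μ := P)
    ((measurable_past hX q.1).prodMk (measurable_future hX (q.1 + (m : ℤ)))).aemeasurable
  have h2 := Measure.isProbabilityMeasure_map (μ := P) (measurable_past hX q.1).aemeasurable
  have h3 := Measure.isProbabilityMeasure_map (μ := P)
    (measurable_future hX (q.1 + (m : ℤ))).aemeasurable
  simp only
  rw [abs_le]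
  constructor <;> linarith [measureReal_le_one (s := q.2.1)
    (μ := P.map (fun ω => (past X q.1 ω, future X (q.1 + (m : ℤ)) ω))),
    measureReal_le_one (s := q.2.1)
      (μ := (P.map (past X q.1)).prod (P.map (future X (q.1 + (m : ℤ))))),
    measureReal_nonneg (s := q.2.1)
      (μ := P.map (fun ω => (past X q.1 ω, future X (q.1 + (m : ℤ)) ω))),
    measureReal_nonneg (s := q.2.1)
      (μ := (P.map (past X q.1)).prod (P.map (future X (q.1 + (m : ℤ)))))]

theorem betaCoeff_nonneg (P : Measure Ω) (X : ℤ → Ω → ℝ) (m : ℕ) : 0 ≤ betaCoeff P X m :=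
  Real.iSup_nonneg fun _ => abs_nonneg _

variable {E : Type*} [AddCommMonoid E] [MeasurableSpace E] [MeasurableAdd₂ E]

/-- The event is the preimage of one event on past and future, so the definition of the mixing
coefficient applies directly. The factors of the product are swapped to match the order in
`iterConv`. -/
theorem map_add_le_prod_add (hX : ∀ t, Measurable (X t)) (t : ℤ) (m : ℕ) {G H : (ℤ → ℝ) → E}
    (hG : Measurable G) (hH : Measurable H) (hGt : ∀ x x', (∀ s ≤ t, x s = x' s) → G x = G x')
    (hHt : ∀ x x', (∀ s, t + (m : ℤ) ≤ s → x s = x' s) → H x = H x')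
    {A : Set E} (hA : MeasurableSet A) :
    P.map (fun ω => G (fun s => X s ω) + H (fun s => X s ω)) A ≤
      (((P.map (fun ω => H (fun s => X s ω))).prod (P.map (fun ω => G (fun s => X s ω)))).map
        (fun p => p.1 + p.2)) A + ENNReal.ofReal (betaCoeff P X m) := by
  classical
  have hpath : Measurable fun ω => fun s => X s ω := measurable_pi_lambda _ hX
  -- The path is extended by `0` outside the observed half-line; by `hGt` and `hHt` the value chosen
  -- there does not matter.
  let u : ({s : ℤ // s ≤ t} → ℝ) → E := fun p => G fun s => if h : s ≤ t then p ⟨s, h⟩ else 0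
  let v : ({s : ℤ // t + (m : ℤ) ≤ s} → ℝ) → E := fun p =>
    H fun s => if h : t + (m : ℤ) ≤ s then p ⟨s, h⟩ else 0
  have hu : Measurable u := by
    refine hG.comp (measurable_pi_lambda _ fun s => ?_)
    by_cases h : s ≤ t
    · simpa [h] using measurable_pi_apply (⟨s, h⟩ : {s : ℤ // s ≤ t})
    · simp [h]
  have hv : Measurable v := by
    refine hH.comp (measurable_pi_lambda _ fun s => ?_)
    by_cases h : t + (m : ℤ) ≤ s
    · simpa [h] using measurable_pi_apply (⟨s, h⟩ : {s : ℤ // t + (m : ℤ) ≤ s})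
    · simp [h]
  have hGu : ∀ ω, G (fun s => X s ω) = u (past X t ω) := by
    intro ω
    refine hGt _ _ fun s hs => ?_
    simp [hs, past]
  have hHv : ∀ ω, H (fun s => X s ω) = v (future X (t + (m : ℤ)) ω) := by
    intro ω
    refine hHt _ _ fun s hs => ?_
    simp [hs, future]
  simp only [hGu, hHv]
  have hp := measurable_past hX t
  have hf := measurable_future hX (t + (m : ℤ))
  have i1 := Measure.isProbabilityMeasure_map (μ := P) hp.aemeasurable
  have i2 := Measure.isProbabilityMeasure_map (μ := P) hf.aemeasurable
  have i3 := Measure.isProbabilityMeasure_map (μ := P) (hp.prodMk hf).aemeasurable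
  have huv : Measurable fun p : ({s : ℤ // s ≤ t} → ℝ) × ({s : ℤ // t + (m : ℤ) ≤ s} → ℝ) =>
      u p.1 + v p.2 := (hu.comp measurable_fst).add (hv.comp measurable_snd)
  have hC := huv hA
  have h := (abs_le.1 (abs_sub_le_betaCoeff (P := P) hX t m hC)).2
  have h1 : P.map (fun ω => u (past X t ω) + v (future X (t + (m : ℤ)) ω)) A =
      P.map (fun ω => (past X t ω, future X (t + (m : ℤ)) ω)) ((fun p => u p.1 + v p.2) ⁻¹' A) := by
    rw [← Measure.map_apply huv hA, Measure.map_map huv (hp.prodMk hf)]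
    rfl
  have h2 : (((P.map (fun ω => v (future X (t + (m : ℤ)) ω))).prod
      (P.map (fun ω => u (past X t ω)))).map (fun p => p.1 + p.2)) A =
      ((P.map (past X t)).prod (P.map (future X (t + (m : ℤ))))) ((fun p => u p.1 + v p.2) ⁻¹' A) := by
    have e1 : P.map (fun ω => v (future X (t + (m : ℤ)) ω))
      = (P.map (future X (t + (m : ℤ)))).map v := (Measure.map_map hv hf).symm
    have e2 : P.map (fun ω => u (past X t ω)) = (P.map (past X t)).map u :=
      (Measure.map_map hu hp).symm
    rw [e1, e2, Measure.map_prod_map _ _ hv hu, Measure.map_map measurable_add (hv.prodMap hu),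
      ← Measure.prod_swap, Measure.map_map (measurable_add.comp (hv.prodMap hu)) measurable_swap,
      Measure.map_apply ((measurable_add.comp (hv.prodMap hu)).comp measurable_swap) hA]
    congr 1
    ext p
    simp [add_comm]
  rw [h1, h2, ← ofReal_measureReal (measure_ne_top _ _), ← ofReal_measureReal (measure_ne_top _ _),
    ← ENNReal.ofReal_add measureReal_nonneg (betaCoeff_nonneg P X m)]
  exact ENNReal.ofReal_le_ofReal (by linarith)

/-- Separated blocks of a stationary process are compared with independent blocks, at the cost of
one mixing coefficient for each gap. -/
theorem map_sum_blocks_le (hX : ∀ t, Measurable (X t)) (hstat : IsStationary P X) {q m : ℕ}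
    (hq : q ≤ m) (τ : ℤ) {g : (Fin (q + 1) → ℝ) → E} (hg : Measurable g) (n : ℕ)
    {A : Set E} (hA : MeasurableSet A) :
    P.map (fun ω => ∑ k ∈ Finset.range (n + 1),
        g fun i => X (τ + ((2 * m * k : ℕ) : ℤ) + (i : ℤ)) ω) A ≤
      iterConv (P.map fun ω => g fun i => X (τ + (i : ℤ)) ω) (n + 1) A +
        n * ENNReal.ofReal (betaCoeff P X m) := by
  set ν := P.map fun ω => g fun i => X (τ + (i : ℤ)) ω with hν
  have hgm : ∀ t : ℤ, Measurable fun ω => g fun i => X (t + (i : ℤ)) ω := fun t =>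
    hg.comp (measurable_pi_lambda _ fun i => hX _)
  have iν : IsProbabilityMeasure ν := Measure.isProbabilityMeasure_map (hgm τ).aemeasurable
  induction n generalizing A with
  | zero =>
    simp only [zero_add, Finset.range_one, Finset.sum_singleton, mul_zero, Nat.cast_zero,
      add_zero, zero_mul]
    rw [iterConv, iterConv, Measure.prod_dirac, Measure.map_map measurable_add measurable_prodMk_right]
    have : ((fun p : E × E => p.1 + p.2) ∘ fun x => (x, (0 : E))) = id := by ext; simp
    rw [this, Measure.map_id]
  | succ n ih =>
    set G : (ℤ → ℝ) → E := fun x => ∑ k ∈ Finset.range (n + 1),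
      g fun i => x (τ + ((2 * m * k : ℕ) : ℤ) + (i : ℤ)) with hG
    set H : (ℤ → ℝ) → E := fun x => g fun i => x (τ + ((2 * m * (n + 1) : ℕ) : ℤ) + (i : ℤ)) with hH
    have hBm : ∀ t : ℤ, Measurable fun x : ℤ → ℝ => g fun i => x (t + (i : ℤ)) := fun t =>
      hg.comp (measurable_pi_lambda _ fun i => measurable_pi_apply _)
    have hGm : Measurable G := Finset.measurable_fun_sum _ fun k _ => hBm _
    have hHm : Measurable H := hBm _
    -- The last of the first `n + 1` blocks ends at `τ + 2mn + q`; as `q ≤ m`, the next block starts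
    -- at least `m` later.
    have hstep := map_add_le_prod_add (P := P) hX (τ + ((2 * m * n + q : ℕ) : ℤ)) m hGm hHm
      (by
        intro x x' h
        refine Finset.sum_congr rfl fun k hk => congrArg g (funext fun i => h _ ?_)
        have h1 : k ≤ n := by have := Finset.mem_range.1 hk; omega
        have h2 := i.2
        have h3 : 2 * m * k ≤ 2 * m * n := Nat.mul_le_mul_left _ h1
        have h4 : (i : ℕ) ≤ q := by omega
        push_cast
        have h3' : (2 * (m : ℤ) * k) ≤ 2 * m * n := by exact_mod_cast h3
        have h4' : ((i : ℕ) : ℤ) ≤ q := by exact_mod_cast h4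
        linarith)
      (by
        intro x x' h
        refine congrArg g (funext fun i => h _ ?_)
        push_cast
        have h4' : (q : ℤ) ≤ m := by exact_mod_cast hq
        have h5 : (0 : ℤ) ≤ ((i : ℕ) : ℤ) := Int.natCast_nonneg _
        linarith)
      hA
    have hsum : (fun ω => ∑ k ∈ Finset.range (n + 1 + 1),
        g fun i => X (τ + ((2 * m * k : ℕ) : ℤ) + (i : ℤ)) ω)
        = fun ω => G (fun s => X s ω) + H (fun s => X s ω) := by
      ext ω
      rw [Finset.sum_range_succ]
    have hlaw : P.map (fun ω => H (fun s => X s ω)) = ν := map_block_eq hX hstat hg τ _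
    rw [hsum]
    refine hstep.trans ?_
    rw [hlaw, iterConv, Measure.map_apply measurable_add hA, Measure.map_apply measurable_add hA,
      Measure.prod_apply (measurable_add hA), Measure.prod_apply (measurable_add hA)]
    -- The induction hypothesis is used on each slice of the event at a fixed last block, which is
    -- why it is stated for every measurable `A`.
    have hle : ∀ y, P.map (fun ω => G (fun s => X s ω)) (Prod.mk y ⁻¹' ((fun p : E × E => p.1 + p.2) ⁻¹' A))
        ≤ iterConv ν (n + 1) (Prod.mk y ⁻¹' ((fun p : E × E => p.1 + p.2) ⁻¹' A)) +
          n * ENNReal.ofReal (betaCoeff P X m) := fun y =>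
      ih (measurable_prodMk_left (measurable_add hA))
    have iG := Measure.isProbabilityMeasure_map (μ := P)
      (hGm.comp (measurable_pi_lambda (fun ω => fun s => X s ω) hX)).aemeasurable
    refine (add_le_add_left (lintegral_mono hle) _).trans ?_
    rw [lintegral_add_right _ measurable_const, lintegral_const, measure_univ, mul_one]
    push_cast
    rw [add_mul, one_mul, add_assoc]

end transfer

/-! ### Block losses on a grid of coefficients. -/

/-- The grid of coefficients of mesh `1 / K` starting at `-1`. -/
noncomputable def gridPt (K i : ℕ) : ℝ := -1 + 1 / (K : ℝ) * (i : ℝ)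

theorem abs_gridPt_le {K i : ℕ} (hK : 0 < K) (hi : i ≤ 2 * K) : |gridPt K i| ≤ 1 := by
  have hK' : (0 : ℝ) < K := Nat.cast_pos.2 hK
  have hi' : (i : ℝ) ≤ 2 * K := by exact_mod_cast hi
  have h : 1 / (K : ℝ) * i ≤ 2 := by
    rw [one_div_mul_eq_div, div_le_iff₀ hK']; exact hi'
  have h0 : 0 ≤ 1 / (K : ℝ) * i := by positivity
  unfold gridPt
  rw [abs_le]
  constructor <;> linarith

/-- The loss, normalised to `[0, 1]`, of the forecast `φ x` of `y`, with weight `w x`. -/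
noncomputable def weightedLoss (w : ℝ → ℝ) (φ x y : ℝ) : ℝ := w x * truncLoss 1 y (φ * x)

/-- The average weighted loss over a block of `m + 1` consecutive values, as a function on the
grid of coefficients; `c` is the scale of the observations. -/
noncomputable def blockLoss (w : ℝ → ℝ) (c : ℝ) (K m : ℕ) (v : Fin (m + 1) → ℝ) : ℕ → ℝ :=
  fun i => (1 / (m : ℝ)) *
    ∑ j : Fin m, weightedLoss w (gridPt K i) (v j.castSucc / c) (v j.succ / c)

theorem measurable_weightedLoss {w : ℝ → ℝ} (hw : Measurable w) (φ : ℝ) :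
    Measurable fun p : ℝ × ℝ => weightedLoss w φ p.1 p.2 := by
  unfold weightedLoss truncLoss
  fun_prop

theorem measurable_blockLoss {w : ℝ → ℝ} (hw : Measurable w) (c : ℝ) (K m : ℕ) :
    Measurable (blockLoss w c K m) := by
  refine measurable_pi_lambda _ fun i => Measurable.const_mul ?_ _
  refine Finset.measurable_fun_sum _ fun j _ => ?_
  exact (measurable_weightedLoss hw (gridPt K i)).comp
    (g := fun p : ℝ × ℝ => weightedLoss w (gridPt K i) p.1 p.2)
    (f := fun v : Fin (m + 1) → ℝ => (v j.castSucc / c, v j.succ / c))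
    (Measurable.prodMk (by fun_prop) (by fun_prop))

theorem weightedLoss_mem_Icc {w : ℝ → ℝ} (hw : ∀ x, w x ∈ Set.Icc (0 : ℝ) 1) (φ x y : ℝ) :
    weightedLoss w φ x y ∈ Set.Icc (0 : ℝ) 1 := by
  have h1 := hw x
  have h2 := truncLoss_one_mem_Icc y (φ * x)
  exact ⟨mul_nonneg h1.1 h2.1, mul_le_one₀ h1.2 h2.1 h2.2⟩

theorem average_mem_Icc {m : ℕ} (hm : 0 < m) {f : Fin m → ℝ}
    (hf : ∀ j, f j ∈ Set.Icc (0 : ℝ) 1) : 1 / (m : ℝ) * ∑ j, f j ∈ Set.Icc (0 : ℝ) 1 := by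
  have hm' : (0 : ℝ) < m := Nat.cast_pos.2 hm
  constructor
  · exact mul_nonneg (by positivity) (Finset.sum_nonneg fun j _ => (hf j).1)
  · rw [one_div_mul_eq_div, div_le_one hm']
    calc ∑ j, f j ≤ ∑ _j : Fin m, (1 : ℝ) := Finset.sum_le_sum fun j _ => (hf j).2
      _ = m := by simp

theorem blockLoss_mem_Icc {w : ℝ → ℝ} (hw : ∀ x, w x ∈ Set.Icc (0 : ℝ) 1) (c : ℝ) (K : ℕ) {m : ℕ}
    (hm : 0 < m) (v : Fin (m + 1) → ℝ) (i : ℕ) : blockLoss w c K m v i ∈ Set.Icc (0 : ℝ) 1 :=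
  average_mem_Icc hm fun _ => weightedLoss_mem_Icc hw _ _ _

/-- Squaring the average over the block is handled by Cauchy–Schwarz, and `w ^ 2 ≤ w` leaves a
single weight, so that only the weighted first moment of the observations enters. -/
theorem sum_sq_blockLoss_le {w : ℝ → ℝ} (hw : ∀ x, w x ∈ Set.Icc (0 : ℝ) 1) (c : ℝ) (K : ℕ) {m : ℕ}
    (hm : 0 < m) (v : Fin (m + 1) → ℝ) (N : ℕ) :
    ∑ i ∈ Finset.range N, (blockLoss w c K m v (i + 1) - blockLoss w c K m v i) ^ 2 ≤
      1 / (m : ℝ) * ∑ j : Fin m,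
        8 / 3 * (1 / (K : ℝ)) * (w (v j.castSucc / c) * |v j.castSucc / c|) := by
  have hm' : (0 : ℝ) < m := Nat.cast_pos.2 hm
  have h1 : ∀ i, (blockLoss w c K m v (i + 1) - blockLoss w c K m v i) ^ 2 ≤
      1 / (m : ℝ) * ∑ j : Fin m, w (v j.castSucc / c) *
        (truncLoss 1 (v j.succ / c) (gridPt K (i + 1) * (v j.castSucc / c))
          - truncLoss 1 (v j.succ / c) (gridPt K i * (v j.castSucc / c))) ^ 2 := by
    intro i
    unfold blockLoss weightedLoss
    rw [← mul_sub, ← Finset.sum_sub_distrib]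
    simp only [← mul_sub]
    rw [mul_pow]
    have hcs := sq_sum_le_card_mul_sum_sq (s := (Finset.univ : Finset (Fin m)))
      (f := fun j => w (v j.castSucc / c) *
        (truncLoss 1 (v j.succ / c) (gridPt K (i + 1) * (v j.castSucc / c))
          - truncLoss 1 (v j.succ / c) (gridPt K i * (v j.castSucc / c))))
    simp only [Finset.card_univ, Fintype.card_fin] at hcs
    calc _ ≤ (1 / (m : ℝ)) ^ 2 * (m * ∑ j : Fin m, (w (v j.castSucc / c) *
        (truncLoss 1 (v j.succ / c) (gridPt K (i + 1) * (v j.castSucc / c))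
          - truncLoss 1 (v j.succ / c) (gridPt K i * (v j.castSucc / c)))) ^ 2) :=
          mul_le_mul_of_nonneg_left hcs (sq_nonneg _)
      _ = 1 / (m : ℝ) * ∑ j : Fin m, (w (v j.castSucc / c) *
        (truncLoss 1 (v j.succ / c) (gridPt K (i + 1) * (v j.castSucc / c))
          - truncLoss 1 (v j.succ / c) (gridPt K i * (v j.castSucc / c)))) ^ 2 := by
          rw [← mul_assoc]
          congr 1
          field_simp
      _ ≤ _ := by
          refine mul_le_mul_of_nonneg_left (Finset.sum_le_sum fun j _ => ?_) (by positivity)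
          rw [mul_pow]
          refine mul_le_mul_of_nonneg_right ?_ (sq_nonneg _)
          have := hw (v j.castSucc / c)
          nlinarith [this.1, this.2]
  refine (Finset.sum_le_sum fun i _ => h1 i).trans ?_
  rw [← Finset.mul_sum, Finset.sum_comm]
  refine mul_le_mul_of_nonneg_left (Finset.sum_le_sum fun j _ => ?_) (by positivity)
  rw [← Finset.mul_sum]
  have h := sum_sq_truncLoss_sub_le (p := -1) (δ := 1 / (K : ℝ)) (by positivity)
    (v j.castSucc / c) (v j.succ / c) N
  have := mul_le_mul_of_nonneg_left h (hw (v j.castSucc / c)).1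
  refine this.trans_eq ?_
  ring

/-! ### Deviation of one family of blocks from the risk. -/

section process

variable {Ω : Type*} [MeasurableSpace Ω] {P : Measure Ω} {X : ℤ → Ω → ℝ}

theorem map_pair_eq (hX : ∀ t, Measurable (X t)) (hstat : IsStationary P X) (t : ℕ) :
    P.map (fun ω => (X t ω, X ((t : ℤ) + 1) ω)) = P.map (fun ω => (X 0 ω, X 1 ω)) := by
  have h := map_block_eq (q := 1) (g := fun v : Fin 2 → ℝ => (v 0, v 1)) hX hstat
    ((measurable_pi_apply 0).prodMk (measurable_pi_apply 1)) 0 t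
  simpa using h

theorem integral_pair_eq (hX : ∀ t, Measurable (X t)) (hstat : IsStationary P X) (t : ℕ)
    {f : ℝ × ℝ → ℝ} (hf : Measurable f) :
    ∫ ω, f (X t ω, X ((t : ℤ) + 1) ω) ∂P = ∫ ω, f (X 0 ω, X 1 ω) ∂P := by
  have h1 := integral_map (μ := P) ((hX t).prodMk (hX ((t : ℤ) + 1))).aemeasurable
    hf.aestronglyMeasurable
  have h2 := integral_map (μ := P) ((hX 0).prodMk (hX 1)).aemeasurable hf.aestronglyMeasurable
  rw [← h1, ← h2, map_pair_eq hX hstat]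

theorem identDistrib_zero (hX : ∀ t, Measurable (X t)) (hstat : IsStationary P X) (t : ℕ) :
    ProbabilityTheory.IdentDistrib (X t) (X 0) P P where
  aemeasurable_fst := (hX t).aemeasurable
  aemeasurable_snd := (hX 0).aemeasurable
  map_eq := by
    have h := congrArg (Measure.map Prod.fst) (map_pair_eq (P := P) hX hstat t)
    rwa [Measure.map_map measurable_fst ((hX t).prodMk (hX ((t : ℤ) + 1))),
      Measure.map_map measurable_fst ((hX 0).prodMk (hX 1))] at h

/-- The expected weighted loss. -/
noncomputable def pairRisk (P : Measure Ω) (X : ℤ → Ω → ℝ) (w : ℝ → ℝ) (c φ : ℝ) : ℝ :=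
  ∫ ω, weightedLoss w φ (X 0 ω / c) (X 1 ω / c) ∂P

theorem integral_weightedLoss (hX : ∀ t, Measurable (X t)) (hstat : IsStationary P X)
    {w : ℝ → ℝ} (hw : Measurable w) (c φ : ℝ) (t : ℕ) :
    ∫ ω, weightedLoss w φ (X t ω / c) (X ((t : ℤ) + 1) ω / c) ∂P = pairRisk P X w c φ :=
  integral_pair_eq hX hstat t (f := fun p => weightedLoss w φ (p.1 / c) (p.2 / c))
    ((measurable_weightedLoss hw φ).comp
      ((measurable_fst.div_const c).prodMk (measurable_snd.div_const c)))

variable [IsProbabilityMeasure P]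

theorem integrable_weightedLoss (hX : ∀ t, Measurable (X t)) {w : ℝ → ℝ} (hw : Measurable w)
    (hw01 : ∀ x, w x ∈ Set.Icc (0 : ℝ) 1) (c φ : ℝ) (s t : ℤ) :
    Integrable (fun ω => weightedLoss w φ (X s ω / c) (X t ω / c)) P :=
  integrable_of_unit ((measurable_weightedLoss hw φ).comp
    (((hX s).div_const c).prodMk ((hX t).div_const c))).aemeasurable
    (Eventually.of_forall fun _ => weightedLoss_mem_Icc hw01 _ _ _)

/-- The average weighted loss over the blocks starting at `s + 2 m k`, `k < μ`, for the `i`-th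
coefficient of the grid. -/
noncomputable def blockRisk (X : ℤ → Ω → ℝ) (w : ℝ → ℝ) (c : ℝ) (K m μ s i : ℕ) (ω : Ω) : ℝ :=
  1 / (μ : ℝ) * ∑ k ∈ Finset.range μ,
    blockLoss w c K m (fun j => X ((s : ℤ) + ((2 * m * k : ℕ) : ℤ) + (j : ℤ)) ω) i

/-- Deviation of the training error over one family of separated blocks from the risk, uniformly
over a grid of coefficients. -/
theorem measure_blocks_deviation_le (hX : ∀ t, Measurable (X t)) (hstat : IsStationary P X)
    {w : ℝ → ℝ} (hw : Measurable w) (hw01 : ∀ x, w x ∈ Set.Icc (0 : ℝ) 1) (c : ℝ) {K m μ : ℕ}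
    (hK : 0 < K) (hm : 0 < m) (hμ : 0 < μ) (s : ℕ) {a : ℝ}
    (hint : Integrable (fun ω => w (X 0 ω / c) * |X 0 ω / c|) P)
    (ha : ∫ ω, w (X 0 ω / c) * |X 0 ω / c| ∂P ≤ a) {r v t : ℝ}
    (hr : ∀ i ≤ 2 * K, pairRisk P X w c (gridPt K i) ≤ r)
    (hv : 1 / 4 ≤ v ∨ (r ≤ 1 / 2 ∧ r * (1 - r) ≤ v)) (hv0 : 0 < v) (ht : 0 ≤ t) :
    P {ω | ∃ i ≤ 2 * K, Real.sqrt (4 * a / (3 * μ)) + t ≤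
        pairRisk P X w c (gridPt K i) - blockRisk X w c K m μ s i ω} ≤
      ENNReal.ofReal (Real.exp (-(μ * t ^ 2 / (2 * v))) + ((μ : ℝ) - 1) * betaCoeff P X m) := by
  have hm' : (0 : ℝ) < m := Nat.cast_pos.2 hm
  have hK' : (0 : ℝ) < K := Nat.cast_pos.2 hK
  have hμ' : (0 : ℝ) < μ := Nat.cast_pos.2 hμ
  have hgm := measurable_blockLoss hw c K m
  have hblk : ∀ t : ℤ, Measurable fun ω => blockLoss w c K m fun j => X (t + (j : ℤ)) ω := fun t =>
    hgm.comp (measurable_pi_lambda _ fun i => hX _)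
  set ν := P.map fun ω => blockLoss w c K m fun j => X ((s : ℤ) + (j : ℤ)) ω with hνdef
  have iν : IsProbabilityMeasure ν := Measure.isProbabilityMeasure_map (hblk s).aemeasurable
  have hν : ∀ᵐ y ∂ν, ∀ i, y i ∈ Set.Icc (0 : ℝ) 1 := by
    rw [hνdef, ae_map_iff (hblk s).aemeasurable]
    · exact Eventually.of_forall fun ω i => blockLoss_mem_Icc hw01 c K hm _ i
    · rw [Set.ofPred_forall]
      exact MeasurableSet.iInter fun i => measurable_pi_apply i measurableSet_Icc
  have hq : ∀ i, ∫ y, y i ∂ν = pairRisk P X w c (gridPt K i) := by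
    intro i
    rw [hνdef, integral_map (hblk s).aemeasurable (measurable_pi_apply i).aestronglyMeasurable]
    unfold blockLoss
    rw [integral_const_mul, integral_finsetSum _ fun j _ =>
      integrable_weightedLoss hX hw hw01 c _ _ _]
    have : ∀ j : Fin m, ∫ ω, weightedLoss w (gridPt K i) (X ((s : ℤ) + (j.castSucc : ℕ)) ω / c)
        (X ((s : ℤ) + (j.succ : ℕ)) ω / c) ∂P = pairRisk P X w c (gridPt K i) := by
      intro j
      rw [← integral_weightedLoss hX hstat hw c (gridPt K i) (s + j)]
      simp [add_assoc]
    rw [Finset.sum_congr rfl fun j _ => this j]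
    simp
    field_simp
  have hwabs : ∀ j : ℕ, Integrable (fun ω => w (X ((s : ℤ) + (j : ℤ)) ω / c)
      * |X ((s : ℤ) + (j : ℤ)) ω / c|) P ∧ ∫ ω, w (X ((s : ℤ) + (j : ℤ)) ω / c)
      * |X ((s : ℤ) + (j : ℤ)) ω / c| ∂P ≤ a := by
    intro j
    have hid := (identDistrib_zero hX hstat (s + j)).comp
      (u := fun x => w (x / c) * |x / c|)
      ((hw.comp (measurable_id.div_const c)).mul (measurable_id.div_const c).abs)
    push_cast at hid
    exact ⟨hid.integrable_iff.2 hint, hid.integral_eq.trans_le ha⟩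
  have hvar : ∑ i ∈ Finset.range (2 * K), ∫ y, (y (i + 1) - y i) ^ 2 ∂ν ≤ 8 / 3 * (1 / K) * a := by
    have e1 : ∀ i, ∫ y, (y (i + 1) - y i) ^ 2 ∂ν = ∫ ω,
        (blockLoss w c K m (fun j => X ((s : ℤ) + (j : ℤ)) ω) (i + 1) -
          blockLoss w c K m (fun j => X ((s : ℤ) + (j : ℤ)) ω) i) ^ 2 ∂P := by
      intro i
      rw [hνdef, integral_map (hblk s).aemeasurable]
      exact (((measurable_pi_apply (i + 1)).sub (measurable_pi_apply i)).pow_const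
        2).aestronglyMeasurable
    have hi : ∀ i, Integrable (fun ω =>
        (blockLoss w c K m (fun j => X ((s : ℤ) + (j : ℤ)) ω) (i + 1) -
          blockLoss w c K m (fun j => X ((s : ℤ) + (j : ℤ)) ω) i) ^ 2) P := by
      intro i
      refine integrable_of_unit ((((measurable_pi_apply (i + 1)).comp (hblk s)).sub
        ((measurable_pi_apply i).comp (hblk s))).pow_const 2).aemeasurable
        (Eventually.of_forall fun ω => ?_)
      have h1 := blockLoss_mem_Icc hw01 c K hm (fun j => X ((s : ℤ) + (j : ℤ)) ω) i
      have h2 := blockLoss_mem_Icc hw01 c K hm (fun j => X ((s : ℤ) + (j : ℤ)) ω) (i + 1)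
      exact ⟨sq_nonneg _, by nlinarith [h1.1, h1.2, h2.1, h2.2]⟩
    simp only [e1]
    rw [← integral_finsetSum _ fun i _ => hi i]
    have hj : ∀ j : Fin m, Integrable (fun ω => 8 / 3 * (1 / (K : ℝ)) *
        (w (X ((s : ℤ) + (j.castSucc : ℕ)) ω / c) * |X ((s : ℤ) + (j.castSucc : ℕ)) ω / c|)) P :=
      fun j => (hwabs j.castSucc).1.const_mul _
    refine (integral_mono (integrable_finsetSum _ fun i _ => hi i)
      ((integrable_finsetSum _ fun j _ => hj j).const_mul _) fun ω =>
        sum_sq_blockLoss_le hw01 c K hm _ _).trans ?_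
    rw [integral_const_mul, integral_finsetSum _ fun j _ => hj j]
    simp only [integral_const_mul]
    rw [← Finset.mul_sum]
    have hs : ∑ j : Fin m, ∫ ω, w (X ((s : ℤ) + (j.castSucc : ℕ)) ω / c)
        * |X ((s : ℤ) + (j.castSucc : ℕ)) ω / c| ∂P ≤ m * a := by
      calc _ ≤ ∑ _j : Fin m, a := Finset.sum_le_sum fun j _ => (hwabs j.castSucc).2
        _ = m * a := by simp
    calc _ ≤ 1 / (m : ℝ) * (8 / 3 * (1 / (K : ℝ)) * (m * a)) := by gcongr
      _ = _ := by field_simp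
  have hmean := integral_gridMax_le hν K μ hvar
  -- The number of grid steps cancels against the mesh: the mean bound is uniform in `K`.
  have hsqrt : Real.sqrt (μ * (K * (8 / 3 * (1 / K) * a) / 2)) =
      μ * Real.sqrt (4 * a / (3 * μ)) := by
    rw [show (μ : ℝ) * (K * (8 / 3 * (1 / K) * a) / 2) = μ ^ 2 * (4 * a / (3 * μ)) by
      field_simp; ring, Real.sqrt_mul (sq_nonneg _), Real.sqrt_sq hμ'.le]
  rw [hsqrt] at hmean
  have htail := gridMax_tail_le hν (N := 2 * K) (fun i hi => (hq i).trans_le (hr i hi)) hv hv0 hμ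
    _ ht hmean
  set A : Set (ℕ → ℝ) := {x | μ * Real.sqrt (4 * a / (3 * μ)) + μ * t ≤
    gridMax (2 * K) (fun i => μ * ∫ y, y i ∂ν) x} with hA
  have hAm : MeasurableSet A := measurableSet_le measurable_const
    ((measurable_gridMax (2 * K)).comp measurable_prodMk_left)
  obtain ⟨μ', rfl⟩ : ∃ k, μ = k + 1 := ⟨μ - 1, by omega⟩
  have htr := map_sum_blocks_le (P := P) hX hstat (le_refl m) (s : ℤ) hgm μ' hAm
  rw [Measure.map_apply (Finset.measurable_fun_sum _ fun k _ => hblk _) hAm] at htr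
  have hexp := Real.exp_pos (-(((μ' + 1 : ℕ) : ℝ) * t ^ 2 / (2 * v)))
  have hβ := betaCoeff_nonneg P X m
  calc _ ≤ P ((fun ω => ∑ k ∈ Finset.range (μ' + 1), blockLoss w c K m
        fun i => X ((s : ℤ) + ((2 * m * k : ℕ) : ℤ) + (i : ℤ)) ω) ⁻¹' A) := by
        refine measure_mono fun ω hω => ?_
        obtain ⟨i, hi, h⟩ := hω
        refine le_trans ?_ (le_gridMax hi _ _)
        simp only [hq, Finset.sum_apply]
        have h2 := mul_le_mul_of_nonneg_left h hμ'.le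
        rw [blockRisk, mul_add, mul_sub, ← mul_assoc, mul_one_div_cancel hμ'.ne', one_mul] at h2
        exact h2
    _ ≤ _ := htr
    _ ≤ ENNReal.ofReal (Real.exp (-(((μ' + 1 : ℕ) : ℝ) * t ^ 2 / (2 * v))))
        + μ' * ENNReal.ofReal (betaCoeff P X m) := by
        gcongr
        rw [← ofReal_measureReal (measure_ne_top _ _)]
        exact ENNReal.ofReal_le_ofReal htail
    _ = _ := by
        rw [← ENNReal.ofReal_natCast, ← ENNReal.ofReal_mul (Nat.cast_nonneg _),
          ← ENNReal.ofReal_add hexp.le (by positivity)]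
        push_cast
        rw [add_sub_cancel_right]

end process

/-! ### The training error as an average of two block families, and the subsample norm. -/

theorem sum_Icc_one_eq_sum_range (f : ℕ → ℝ) (N : ℕ) :
    ∑ t ∈ Finset.Icc 1 N, f t = ∑ t ∈ Finset.range N, f (t + 1) := by
  induction N with
  | zero => simp
  | succ N ih => rw [Finset.sum_Icc_succ_top (by omega), ih, Finset.sum_range_succ]

theorem sum_Icc_eq_sum_blocks (f : ℕ → ℝ) (μ m : ℕ) :
    ∑ t ∈ Finset.Icc 1 (2 * μ * m), f t =
      ∑ k ∈ Finset.range μ, ∑ j : Fin m, f (1 + 2 * m * k + j) +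
      ∑ k ∈ Finset.range μ, ∑ j : Fin m, f (m + 1 + 2 * m * k + j) := by
  rw [sum_Icc_one_eq_sum_range]
  induction μ with
  | zero => simp
  | succ μ ih =>
    rw [show 2 * (μ + 1) * m = 2 * μ * m + m + m by ring, Finset.sum_range_add,
      Finset.sum_range_add, ih, Finset.sum_range_succ, Finset.sum_range_succ,
      ← Fin.sum_univ_eq_sum_range (fun x => f (2 * μ * m + x + 1)),
      ← Fin.sum_univ_eq_sum_range (fun x => f (2 * μ * m + m + x + 1))]
    have h1 : ∀ j : Fin m, f (2 * μ * m + j + 1) = f (1 + 2 * m * μ + j) := fun j =>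
      congrArg f (by ring)
    have h2 : ∀ j : Fin m, f (2 * μ * m + m + j + 1) = f (m + 1 + 2 * m * μ + j) := fun j =>
      congrArg f (by ring)
    simp only [h1, h2]
    ring

section path

variable {Ω : Type*} {X : ℤ → Ω → ℝ}

theorem arForecast_one (φ : Fin 1 → ℝ) (x : ℤ → ℝ) (t : ℤ) : arForecast φ x t = φ 0 * x t := by
  simp [arForecast]

theorem trainingError_eq_blockRisk {M : ℝ} (hM : 0 < M) {μ m : ℕ} (hμ : 0 < μ) (hm : 0 < m)
    (K i : ℕ) (ω : Ω) :
    trainingError X M (2 * μ * m) (fun _ : Fin 1 => gridPt K i) ω =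
      M * ((blockRisk X (fun _ => 1) (Real.sqrt M) K m μ 1 i ω +
        blockRisk X (fun _ => 1) (Real.sqrt M) K m μ (m + 1) i ω) / 2) := by
  have hm' : (m : ℝ) ≠ 0 := Nat.cast_ne_zero.2 hm.ne'
  have hμ' : (μ : ℝ) ≠ 0 := Nat.cast_ne_zero.2 hμ.ne'
  have hterm : ∀ t : ℤ, truncLoss M (X (t + 1) ω)
      (arForecast (fun _ : Fin 1 => gridPt K i) (fun s => X s ω) t) =
      M * weightedLoss (fun _ => 1) (gridPt K i) (X t ω / Real.sqrt M)
        (X (t + 1) ω / Real.sqrt M) := by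
    intro t
    rw [arForecast_one, truncLoss_eq_mul hM, weightedLoss, one_mul, mul_div_assoc]
  have hblock : ∀ s : ℕ, blockRisk X (fun _ => 1) (Real.sqrt M) K m μ s i ω =
      1 / (μ : ℝ) * (1 / (m : ℝ) * ∑ k ∈ Finset.range μ, ∑ j : Fin m,
        weightedLoss (fun _ => 1) (gridPt K i)
          (X ((s + 2 * m * k + j : ℕ) : ℤ) ω / Real.sqrt M)
          (X (((s + 2 * m * k + j : ℕ) : ℤ) + 1) ω / Real.sqrt M)) := by
    intro s
    unfold blockRisk blockLoss
    rw [← Finset.mul_sum]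
    simp [add_assoc]
  unfold trainingError
  simp only [hterm]
  rw [sum_Icc_eq_sum_blocks (fun t : ℕ => M * weightedLoss (fun _ => 1) (gridPt K i)
    (X (t : ℤ) ω / Real.sqrt M) (X ((t : ℤ) + 1) ω / Real.sqrt M)), hblock, hblock]
  simp only [← Finset.mul_sum]
  push_cast
  field_simp

theorem continuous_trainingError (M : ℝ) (n : ℕ) (ω : Ω) :
    Continuous fun φ : ℝ => trainingError X M n (fun _ : Fin 1 => φ) ω := by
  unfold trainingError truncLoss arForecast
  fun_prop

theorem subsampleNorm_nonneg (X : ℤ → Ω → ℝ) (μ m : ℕ) (ω : Ω) : 0 ≤ subsampleNorm X μ m ω :=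
  Real.sqrt_nonneg _

theorem sum_abs_le_subsampleNorm (X : ℤ → Ω → ℝ) (μ m : ℕ) (ω : Ω) :
    ∑ k ∈ Finset.range μ, |X ((m / 2 + 2 * m * k : ℕ) : ℤ) ω| ≤
      Real.sqrt μ * subsampleNorm X μ m ω := by
  unfold subsampleNorm
  rw [← Real.sqrt_mul (Nat.cast_nonneg μ)]
  apply Real.le_sqrt_of_sq_le
  have h := sq_sum_le_card_mul_sum_sq (s := Finset.range μ)
    (f := fun k => |X ((m / 2 + 2 * m * k : ℕ) : ℤ) ω|)
  simpa only [sq_abs, Finset.card_range] using h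

theorem abs_le_subsampleNorm (X : ℤ → Ω → ℝ) {μ m k : ℕ} (hk : k < μ) (ω : Ω) :
    |X ((m / 2 + 2 * m * k : ℕ) : ℤ) ω| ≤ subsampleNorm X μ m ω := by
  unfold subsampleNorm
  apply Real.le_sqrt_of_sq_le
  rw [sq_abs]
  exact Finset.single_le_sum (f := fun k => X ((m / 2 + 2 * m * k : ℕ) : ℤ) ω ^ 2)
    (fun i _ => sq_nonneg _) (Finset.mem_range.2 hk)

end path

/-! ### From grids to the whole stability domain. -/

section process

variable {Ω : Type*} [MeasurableSpace Ω] {P : Measure Ω} {X : ℤ → Ω → ℝ}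

theorem risk_eq_pairRisk (hX : ∀ t, Measurable (X t)) (hstat : IsStationary P X) {M : ℝ}
    (hM : 0 < M) (n : ℕ) (φ : Fin 1 → ℝ) :
    risk P X M n φ = M * pairRisk P X (fun _ => 1) (Real.sqrt M) (φ 0) := by
  unfold risk
  rw [← integral_weightedLoss hX hstat measurable_const _ _ n, ← integral_const_mul]
  congr 1
  ext ω
  rw [arForecast_one, truncLoss_eq_mul hM, weightedLoss, one_mul, mul_div_assoc]

variable [IsProbabilityMeasure P]

theorem continuous_risk (hX : ∀ t, Measurable (X t)) {M : ℝ} (hM : 0 ≤ M) (n : ℕ) :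
    Continuous fun φ : ℝ => risk P X M n (fun _ : Fin 1 => φ) := by
  unfold risk
  refine continuous_of_dominated (bound := fun _ => M) ?_ ?_ (integrable_const _) ?_
  · intro φ
    simp only [arForecast_one]
    unfold truncLoss
    exact (by fun_prop : Measurable _).aestronglyMeasurable
  · intro φ
    refine Eventually.of_forall fun ω => ?_
    rw [Real.norm_eq_abs, abs_of_nonneg (truncLoss_nonneg hM _ _)]
    exact truncLoss_le _ _ _
  · refine Eventually.of_forall fun ω => ?_
    unfold truncLoss arForecast
    fun_prop

theorem exists_gridPt_near {φ : ℝ} (hφ : |φ| < 1) {K : ℕ} (hK : 0 < K) :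
    ∃ i ≤ 2 * K, |gridPt K i - φ| ≤ 1 / K := by
  have hK' : (0 : ℝ) < K := Nat.cast_pos.2 hK
  obtain ⟨h1, h2⟩ := abs_lt.1 hφ
  have h0 : 0 ≤ (φ + 1) * K := mul_nonneg (by linarith) hK'.le
  refine ⟨⌊(φ + 1) * K⌋₊, ?_, ?_⟩
  · apply Nat.floor_le_of_le
    push_cast
    exact mul_le_mul_of_nonneg_right (by linarith) hK'.le
  · have h3 := Nat.floor_le h0
    have h4 := Nat.lt_floor_add_one ((φ + 1) * K)
    have h5 : gridPt K ⌊(φ + 1) * K⌋₊ - φ = ((⌊(φ + 1) * K⌋₊ : ℝ) - (φ + 1) * K) / K := by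
      unfold gridPt
      field_simp
      ring
    rw [h5, abs_div, abs_of_pos hK']
    refine div_le_div_of_nonneg_right ?_ hK'.le
    rw [abs_le]
    constructor <;> linarith

/-- A bound that holds on every grid of coefficients holds on the whole stability domain. -/
theorem measure_exists_coeff_le (hX : ∀ t, Measurable (X t)) {M : ℝ} (hM : 0 ≤ M) (n : ℕ)
    (B : Ω → ℝ) {p : ENNReal}
    (h : ∀ K, 0 < K → P {ω | ∃ i ≤ 2 * K, trainingError X M n (fun _ : Fin 1 => gridPt K i) ω + B ω
      < risk P X M n (fun _ : Fin 1 => gridPt K i)} ≤ p) :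
    P {ω | ∃ φ ∈ stabilityDomain 1, trainingError X M n φ ω + B ω < risk P X M n φ} ≤ p := by
  set V : ℕ → Set Ω := fun K => {ω | ∃ i ≤ 2 * K,
    trainingError X M n (fun _ : Fin 1 => gridPt K i) ω + B ω
      < risk P X M n (fun _ : Fin 1 => gridPt K i)} with hV
  -- The grids are not nested, so the limit inferior of the events `V K` is used. A strict violation
  -- at one coefficient persists nearby, hence occurs on every fine enough grid. Continuity from
  -- below holds for the outer measure, so no measurability of these events is needed.
  set A : ℕ → Set Ω := fun N => ⋂ K ≥ N + 1, V K with hA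
  have hAmono : Monotone A := by
    intro a b hab
    exact Set.biInter_subset_biInter_left fun K (hK : b + 1 ≤ K) => (by omega : a + 1 ≤ K)
  have hsub : {ω | ∃ φ ∈ stabilityDomain 1, trainingError X M n φ ω + B ω < risk P X M n φ} ⊆
      ⋃ N, A N := by
    rintro ω ⟨φ, hφ, hlt⟩
    rw [mem_stabilityDomain_one] at hφ
    have hφ0 : φ = fun _ => φ 0 := by
      ext i; rw [Subsingleton.elim i 0]
    rw [hφ0] at hlt
    have hopen : IsOpen {x : ℝ | trainingError X M n (fun _ : Fin 1 => x) ω + B ω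
        < risk P X M n (fun _ : Fin 1 => x)} :=
      isOpen_lt ((continuous_trainingError M n ω).add continuous_const) (continuous_risk hX hM n)
    obtain ⟨ε, hε, hball⟩ := Metric.isOpen_iff.1 hopen (φ 0) hlt
    obtain ⟨N, hN⟩ := exists_nat_one_div_lt hε
    rw [Set.mem_iUnion]
    refine ⟨N, Set.mem_iInter₂.2 fun K hK => ?_⟩
    have hK' : N + 1 ≤ K := hK
    obtain ⟨i, hi, hd⟩ := exists_gridPt_near hφ (by omega : 0 < K)
    refine ⟨i, hi, hball ?_⟩
    rw [Metric.mem_ball, Real.dist_eq]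
    refine lt_of_le_of_lt (hd.trans ?_) hN
    apply one_div_le_one_div_of_le (by positivity)
    exact_mod_cast hK'
  refine (measure_mono hsub).trans ?_
  rw [hAmono.measure_iUnion]
  refine iSup_le fun N => (measure_mono ?_).trans (h (N + 1) (by omega))
  exact Set.biInter_subset_of_mem (le_refl (N + 1))

theorem ofReal_one_sub_le_measure {η : ℝ} (hη : 0 ≤ η) {V W : Set Ω}
    (hV : P V ≤ ENNReal.ofReal η) (hW : Vᶜ ⊆ W) : ENNReal.ofReal (1 - η) ≤ P W := by
  rw [ENNReal.ofReal_sub _ hη, ENNReal.ofReal_one, tsub_le_iff_right]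
  calc (1 : ENNReal) = P (Vᶜ ∪ V) := by rw [Set.compl_union_self, measure_univ]
    _ ≤ P Vᶜ + P V := measure_union_le _ _
    _ ≤ P W + ENNReal.ofReal η := add_le_add (measure_mono hW) hV

theorem measurable_subsampleNorm (hX : ∀ t, Measurable (X t)) (μ m : ℕ) :
    Measurable (subsampleNorm X μ m) := by
  unfold subsampleNorm
  exact (Finset.measurable_fun_sum _ fun k _ => (hX _).pow_const 2).sqrt

end process

/-! ### Numerical inequalities, lower tails and the truncation level. -/

theorem sqrt_le_half_add {x k : ℝ} (hx : 0 ≤ x) (hk : 0 < k) :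
    Real.sqrt x ≤ (x / k + k) / 2 := by
  have h1 := Real.sq_sqrt hx
  have h2 : x / k * k = x := div_mul_cancel₀ x hk.ne'
  have h3 : 0 ≤ k * ((x / k + k) / 2 - Real.sqrt x) := by
    nlinarith [sq_nonneg (Real.sqrt x - k)]
  exact sub_nonneg.1 (nonneg_of_mul_nonneg_right h3 hk)

theorem le_two_mul_sqrt_two : (2.828 : ℝ) ≤ 2 * Real.sqrt 2 := by
  have : (1.414 : ℝ) ≤ Real.sqrt 2 := Real.le_sqrt_of_sq_le (by norm_num)
  linarith

/-- The reduction of the variance for small `a` pays for the mean deviation `√(4a/3)`. -/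
theorem exists_variance_factor {a l : ℝ} (ha : 0 ≤ a) (hl : 0.588 ≤ l) :
    ∃ θ : ℝ, 0 < θ ∧
      (1 / 4 ≤ θ ^ 2 / 4 ∨ (2 * a ≤ 1 / 2 ∧ 2 * a * (1 - 2 * a) ≤ θ ^ 2 / 4)) ∧
      Real.sqrt (4 * a / 3) + θ * l ≤ 2 * Real.sqrt 2 * a + l := by
  have h2 := le_two_mul_sqrt_two
  rcases le_total (1 / 6) a with h | h
  · refine ⟨1, one_pos, Or.inl (by norm_num), ?_⟩
    have : Real.sqrt (4 * a / 3) ≤ 2 * Real.sqrt 2 * a := by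
      apply Real.sqrt_le_iff.2
      refine ⟨by positivity, ?_⟩
      rw [mul_pow, mul_pow, Real.sq_sqrt zero_le_two]
      nlinarith
    linarith
  -- Since `4 · 2a (1 - 2a) = 1 - (1 - 4a)²`, the ideal factor is `√(1 - (1 - 4a)²)`; `√(1 - u) ≤ 1
  -- - u / 2` gives this polynomial majorant.
  · refine ⟨1 - (1 - 4 * a) ^ 2 / 2, by nlinarith, Or.inr ⟨by linarith, ?_⟩, ?_⟩
    · nlinarith [sq_nonneg ((1 - 4 * a) ^ 2)]
    -- The square root is replaced by its tangent at `0.42 ^ 2`. What remains is a quadratic in `a`,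
    -- positive with minimum near `0.118`.
    · have h1 := sqrt_le_half_add (x := 4 * a / 3) (k := 0.42) (by positivity) (by norm_num)
      have h3 : 0.588 * (1 - 4 * a) ^ 2 ≤ l * (1 - 4 * a) ^ 2 :=
        mul_le_mul_of_nonneg_right hl (sq_nonneg _)
      have h4 : 2.828 * a ≤ 2 * Real.sqrt 2 * a := mul_le_mul_of_nonneg_right h2 ha
      have h5 : (4 * a / 3 / 0.42 + 0.42) / 2 ≤ 1.588 * a + 0.21 := by
        norm_num; linarith
      nlinarith [sq_nonneg (a - 0.118)]

theorem integral_exp_neg_iterConv_le {ν : Measure ℝ} [IsProbabilityMeasure ν]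
    (hν : ∀ᵐ y ∂ν, y ∈ Set.Icc (0 : ℝ) 1) {l : ℝ} (hl : 0 ≤ l) (n : ℕ) :
    Integrable (fun x => Real.exp (-(l * x))) (iterConv ν n) ∧
    ∫ x, Real.exp (-(l * x)) ∂iterConv ν n ≤
      Real.exp (-(n * ((∫ y, y ∂ν) * (1 - Real.exp (-l))))) := by
  have hm : Measurable fun x : ℝ => Real.exp (-(l * x)) := by fun_prop
  have hpos : ∀ n, ∀ᵐ x ∂iterConv ν n, (0 : ℝ) ≤ x := by
    intro n
    induction n with
    | zero =>
      rw [iterConv, ae_dirac_iff measurableSet_Ici]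
    | succ n ih =>
      exact ae_iterConv_succ hν ih measurableSet_Ici fun y x hy hx => add_nonneg hy.1 hx
  have hint : ∀ n, Integrable (fun x => Real.exp (-(l * x))) (iterConv ν n) := by
    intro n
    refine Integrable.of_mem_Icc 0 1 hm.aemeasurable ?_
    filter_upwards [hpos n] with x hx
    exact ⟨(Real.exp_pos _).le, Real.exp_le_one_iff.2 (by nlinarith [mul_nonneg hl hx])⟩
  refine ⟨hint n, ?_⟩
  induction n with
  | zero => rw [iterConv, integral_dirac' _ _ hm.stronglyMeasurable]; simp
  | succ n ih =>
    rw [integral_iterConv_succ hm (hint (n + 1))]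
    simp only [mul_add, neg_add, Real.exp_add, integral_const_mul, integral_mul_const]
    have h1 := integral_exp_neg_le_chord (ν := ν) aemeasurable_id hν hl
    simp only [id] at h1
    have h2 : ∫ y, Real.exp (-(l * y)) ∂ν ≤
        Real.exp (-((∫ y, y ∂ν) * (1 - Real.exp (-l)))) := by
      refine h1.trans ?_
      have := Real.add_one_le_exp (-((∫ y, y ∂ν) * (1 - Real.exp (-l))))
      linarith
    calc _ ≤ Real.exp (-((∫ y, y ∂ν) * (1 - Real.exp (-l)))) *
          Real.exp (-(n * ((∫ y, y ∂ν) * (1 - Real.exp (-l))))) :=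
          mul_le_mul h2 ih (integral_nonneg fun _ => (Real.exp_pos _).le) (Real.exp_pos _).le
      _ = _ := by
          rw [← Real.exp_add]
          congr 1
          push_cast
          ring

/-- A sum of independent `[0, 1]`-valued variables is rarely below a sixth of its mean. -/
theorem iterConv_real_lt_le {ν : Measure ℝ} [IsProbabilityMeasure ν]
    (hν : ∀ᵐ y ∂ν, y ∈ Set.Icc (0 : ℝ) 1) (n : ℕ) :
    (iterConv ν n).real {x | x ≤ 0.16 * (n * ∫ y, y ∂ν)} ≤
      Real.exp (-(n * (∫ y, y ∂ν) / 2)) := by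
  obtain ⟨hi, hle⟩ := integral_exp_neg_iterConv_le hν zero_le_two n
  have hq : 0 ≤ ∫ y, y ∂ν := integral_nonneg_of_ae (by filter_upwards [hν] with y hy using hy.1)
  -- With exponent `2` the rate is `1 - exp (-2) - 2 · 0.16`, which is at least `1/2` because `exp
  -- (-2) ≤ 0.18`.
  have h := ProbabilityTheory.measure_le_le_exp_mul_mgf (μ := iterConv ν n) (X := id)
    (0.16 * (n * ∫ y, y ∂ν)) (t := -2) (by norm_num) (by simpa using hi)
  simp only [ProbabilityTheory.mgf, id] at h
  refine h.trans ?_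
  have h2 : ∀ x : ℝ, -2 * x = -(2 * x) := fun x => by ring
  simp only [h2]
  refine (mul_le_mul_of_nonneg_left hle (Real.exp_pos _).le).trans ?_
  rw [← Real.exp_add]
  apply Real.exp_le_exp.2
  have he : Real.exp (-2) ≤ 0.18 := by
    rw [Real.exp_neg]
    rw [inv_le_comm₀ (Real.exp_pos _) (by norm_num)]
    have h1 := Real.exp_one_gt_d9
    have h3 : Real.exp 2 = Real.exp 1 * Real.exp 1 := by rw [← Real.exp_add]; norm_num
    rw [h3]
    nlinarith
  have hn : 0 ≤ n * ∫ y, y ∂ν := mul_nonneg (Nat.cast_nonneg n) hq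
  nlinarith

/-- The level is the `(1 - r)`-quantile on `[0, ∞)`. Right continuity of the distribution function
bounds the tail at `T`. Below `T` the tail exceeds `r`, so `r t²` is below the truncated second
moment, and `t` tends to `T`. The second property keeps the mean of the squares normalised by `T ^
2` at least `r`, as the lower-tail estimate requires. -/
theorem exists_truncation_level {Ω : Type*} [MeasurableSpace Ω] {P : Measure Ω}
    [IsProbabilityMeasure P] {ξ : Ω → ℝ} (hξ : Measurable ξ) {r : ℝ} (hr : 0 < r) :
    ∃ T, 0 ≤ T ∧ P.real {ω | T < ξ ω} ≤ r ∧ r * T ^ 2 ≤ ∫ ω, min (ξ ω ^ 2) (T ^ 2) ∂P := by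
  have iρ := Measure.isProbabilityMeasure_map (μ := P) hξ.aemeasurable
  set F := ProbabilityTheory.cdf (P.map ξ) with hF
  have htail : ∀ t, P.real {ω | t < ξ ω} = 1 - F t := by
    intro t
    rw [hF, ProbabilityTheory.cdf_eq_real, map_measureReal_apply hξ measurableSet_Iic]
    have := measureReal_compl (μ := P) (hξ (measurableSet_Iic (a := t)))
    rw [probReal_univ] at this
    rw [← this]
    congr 1
    ext ω
    simp
  set S : Set ℝ := {t | 0 ≤ t ∧ 1 - r ≤ F t} with hS
  have hne : S.Nonempty := by
    have h1 : ∀ᶠ t in atTop, 1 - r < F t :=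
      (ProbabilityTheory.tendsto_cdf_atTop (P.map ξ)).eventually (lt_mem_nhds (by linarith))
    obtain ⟨t, ht1, ht2⟩ := (h1.and (eventually_ge_atTop 0)).exists
    exact ⟨t, ht2, ht1.le⟩
  have hbdd : BddBelow S := ⟨0, fun t ht => ht.1⟩
  have hT0 : 0 ≤ sInf S := le_csInf hne fun t ht => ht.1
  have hFT : 1 - r ≤ F (sInf S) := by
    have hc : Tendsto F (𝓝[>] (sInf S)) (𝓝 (F (sInf S))) :=
      (F.right_continuous (sInf S)).mono_left (nhdsWithin_mono _ Set.Ioi_subset_Ici_self)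
    refine ge_of_tendsto hc ?_
    filter_upwards [self_mem_nhdsWithin] with t ht
    obtain ⟨s, hs, hst⟩ := exists_lt_of_csInf_lt hne ht
    exact hs.2.trans (F.mono hst.le)
  refine ⟨sInf S, hT0, by rw [htail]; linarith, ?_⟩
  rcases hT0.eq_or_lt with h0 | h0
  · rw [← h0]
    simp only [ne_eq, OfNat.ofNat_ne_zero, not_false_eq_true, zero_pow, mul_zero]
    exact integral_nonneg fun ω => le_min (sq_nonneg _) le_rfl
  · have hlim : Tendsto (fun t : ℝ => r * t ^ 2) (𝓝[<] (sInf S)) (𝓝 (r * sInf S ^ 2)) :=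
      ((continuous_const.mul (continuous_id.pow 2)).tendsto (sInf S)).mono_left
        nhdsWithin_le_nhds
    refine le_of_tendsto hlim ?_
    filter_upwards [self_mem_nhdsWithin,
      nhdsWithin_le_nhds (lt_mem_nhds h0)] with t ht ht0
    have hnot : t ∉ S := fun h => not_lt.2 (csInf_le hbdd h) ht
    have hFt : F t < 1 - r := by
      by_contra hcon
      exact hnot ⟨le_of_lt ht0, not_lt.1 hcon⟩
    have hp : r ≤ P.real {ω | t < ξ ω} := by rw [htail]; linarith
    have hms : MeasurableSet {ω | t < ξ ω} := hξ measurableSet_Ioi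
    have hle : ∫ ω, {ω | t < ξ ω}.indicator (fun _ => t ^ 2) ω ∂P ≤
        ∫ ω, min (ξ ω ^ 2) (sInf S ^ 2) ∂P := by
      refine integral_mono ((integrable_const _).indicator hms) ?_ fun ω => ?_
      · exact Integrable.of_mem_Icc 0 (sInf S ^ 2) (by fun_prop)
          (Eventually.of_forall fun ω => ⟨le_min (sq_nonneg _) (sq_nonneg _), min_le_right _ _⟩)
      · simp only [Set.indicator_apply]
        split_ifs with h
        · have h' : t < ξ ω := h
          have ht' : t < sInf S := ht
          have ht0' : 0 < t := ht0
          exact le_min (by nlinarith) (by nlinarith)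
        · exact le_min (sq_nonneg _) (sq_nonneg _)
    rw [integral_indicator_const _ hms, smul_eq_mul] at hle
    nlinarith [sq_nonneg t]

section process

variable {Ω : Type*} [MeasurableSpace Ω] {P : Measure Ω} [IsProbabilityMeasure P] {X : ℤ → Ω → ℝ}

theorem integral_le_sqrt_of_sq_le {f : Ω → ℝ} {b : ℝ} (hf : MemLp f 2 P)
    (h : ∫ ω, f ω ^ 2 ∂P ≤ b) : ∫ ω, f ω ∂P ≤ Real.sqrt b := by
  apply Real.le_sqrt_of_sq_le
  have hv := ProbabilityTheory.variance_nonneg f P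
  rw [ProbabilityTheory.variance_eq_sub hf] at hv
  simp only [Pi.pow_apply] at hv
  linarith

/-- The truncated sum of squares over separated times is rarely below a sixth of its mean. -/
theorem measure_sum_min_sq_lt_le (hX : ∀ t, Measurable (X t)) (hstat : IsStationary P X) (c : ℝ)
    {m μ : ℕ} (hμ : 0 < μ) (s : ℕ) {T r : ℝ} (hT : 0 ≤ T)
    (hr : r * T ^ 2 ≤ ∫ ω, min (|X 0 ω / c| ^ 2) (T ^ 2) ∂P) :
    P {ω | ∑ k ∈ Finset.range μ, min (|X ((s + 2 * m * k : ℕ) : ℤ) ω / c| ^ 2) (T ^ 2) <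
        0.16 * (μ * ∫ ω, min (|X 0 ω / c| ^ 2) (T ^ 2) ∂P)} ≤
      ENNReal.ofReal (Real.exp (-(μ * r / 2)) + ((μ : ℝ) - 1) * betaCoeff P X m) := by
  rcases hT.eq_or_lt with rfl | hT0
  · have : {ω | ∑ k ∈ Finset.range μ, min (|X ((s + 2 * m * k : ℕ) : ℤ) ω / c| ^ 2) ((0 : ℝ) ^ 2) <
        0.16 * (μ * ∫ ω, min (|X 0 ω / c| ^ 2) ((0 : ℝ) ^ 2) ∂P)} = ∅ := by
      have h0 : ∀ x : ℝ, min (|x| ^ 2) ((0 : ℝ) ^ 2) = 0 := fun x => by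
        rw [min_eq_right] <;> simp
        positivity
      simp only [h0]
      simp
    rw [this, measure_empty]
    exact zero_le
  · have hT2 : 0 < T ^ 2 := by positivity
    let g : (Fin (0 + 1) → ℝ) → ℝ := fun v => min (|v 0 / c| ^ 2) (T ^ 2) / T ^ 2
    have hg : Measurable g := by fun_prop
    have hgb : ∀ t : ℤ, Measurable fun ω => g fun i => X (t + (i : ℤ)) ω := fun t =>
      hg.comp (measurable_pi_lambda _ fun i => hX _)
    set ν := P.map fun ω => g fun i => X ((s : ℤ) + (i : ℤ)) ω with hνdef
    have iν : IsProbabilityMeasure ν := Measure.isProbabilityMeasure_map (hgb s).aemeasurable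
    have hν : ∀ᵐ y ∂ν, y ∈ Set.Icc (0 : ℝ) 1 := by
      refine (ae_map_iff (p := fun y => y ∈ Set.Icc (0 : ℝ) 1) (hgb s).aemeasurable
        measurableSet_Icc).2 ?_
      refine Eventually.of_forall fun ω => ⟨?_, ?_⟩
      · exact div_nonneg (le_min (sq_nonneg _) hT2.le) hT2.le
      · exact (div_le_one hT2).2 (min_le_right _ _)
    have hq : ∫ y, y ∂ν = (∫ ω, min (|X 0 ω / c| ^ 2) (T ^ 2) ∂P) / T ^ 2 := by
      rw [hνdef, integral_map (hgb s).aemeasurable (f := fun y : ℝ => y)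
        measurable_id.aestronglyMeasurable, ← integral_div]
      have := ((identDistrib_zero (P := P) hX hstat s).comp
        (u := fun x => min (|x / c| ^ 2) (T ^ 2) / T ^ 2) (by fun_prop)).integral_eq
      simpa [g] using this
    obtain ⟨μ', rfl⟩ : ∃ k, μ = k + 1 := ⟨μ - 1, by omega⟩
    have hA : MeasurableSet {x : ℝ | x ≤ 0.16 * (((μ' + 1 : ℕ) : ℝ) * ∫ y, y ∂ν)} :=
      measurableSet_Iic
    have htr := map_sum_blocks_le (P := P) hX hstat (Nat.zero_le m) (s : ℤ) hg μ' hA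
    rw [Measure.map_apply (Finset.measurable_fun_sum _ fun k _ => hgb _) hA] at htr
    have hexp := Real.exp_pos (-(((μ' + 1 : ℕ) : ℝ) * r / 2))
    have hβ := betaCoeff_nonneg P X m
    have hrq : r ≤ ∫ y, y ∂ν := by rw [hq, le_div_iff₀ hT2]; exact hr
    calc _ ≤ P ((fun ω => ∑ k ∈ Finset.range (μ' + 1),
          g fun i => X ((s : ℤ) + ((2 * m * k : ℕ) : ℤ) + (i : ℤ)) ω) ⁻¹'
            {x : ℝ | x ≤ 0.16 * (((μ' + 1 : ℕ) : ℝ) * ∫ y, y ∂ν)}) := by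
          refine measure_mono fun ω hω => ?_
          rw [Set.mem_ofPred_eq] at hω
          have hω' := hω.le
          rw [Set.mem_preimage, Set.mem_ofPred_eq]
          simp only [g, ← Finset.sum_div, hq]
          rw [div_le_iff₀ hT2]
          refine le_trans (le_of_eq ?_) (hω'.trans_eq ?_)
          · simp
          · field_simp
      _ ≤ _ := htr
      _ ≤ ENNReal.ofReal (Real.exp (-(((μ' + 1 : ℕ) : ℝ) * r / 2)))
          + μ' * ENNReal.ofReal (betaCoeff P X m) := by
          gcongr
          rw [← ofReal_measureReal (measure_ne_top _ _)]
          refine ENNReal.ofReal_le_ofReal ((iterConv_real_lt_le hν (μ' + 1)).trans ?_)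
          apply Real.exp_le_exp.2
          have := mul_le_mul_of_nonneg_left hrq (Nat.cast_nonneg (α := ℝ) (μ' + 1))
          linarith
      _ = _ := by
          rw [← ENNReal.ofReal_natCast, ← ENNReal.ofReal_mul (Nat.cast_nonneg _),
            ← ENNReal.ofReal_add hexp.le (by positivity)]
          push_cast
          rw [add_sub_cancel_right]

end process

/-! ### Truncation weights and normalisation of the bounds. -/

/-- The weight that discards values above the level `T`. -/
noncomputable def truncWeight (T x : ℝ) : ℝ := if |x| ≤ T then 1 else 0

theorem measurable_truncWeight (T : ℝ) : Measurable (truncWeight T) :=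
  Measurable.ite (measurableSet_le measurable_id.abs measurable_const) measurable_const
    measurable_const

theorem truncWeight_mem_Icc (T x : ℝ) : truncWeight T x ∈ Set.Icc (0 : ℝ) 1 := by
  unfold truncWeight
  split_ifs <;> simp

theorem blockRisk_truncWeight_le {Ω : Type*} (X : ℤ → Ω → ℝ) (c T : ℝ) (K m μ s i : ℕ) (ω : Ω) :
    blockRisk X (truncWeight T) c K m μ s i ω ≤ blockRisk X (fun _ => 1) c K m μ s i ω := by
  unfold blockRisk blockLoss weightedLoss
  gcongr with k _ j _
  · exact (truncLoss_one_mem_Icc _ _).1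
  · exact (truncWeight_mem_Icc T _).2

/-- The product of the constant of the Rademacher term with a norm of normalised observations. -/
theorem norm_term_eq {M : ℝ} (hM : 0 < M) {μ : ℕ} (hμ : 0 < μ) (z : ℝ) :
    4 / (μ : ℝ) * Real.sqrt (M / 2) * (Real.sqrt M * (Real.sqrt μ * z)) =
      M * (2 * Real.sqrt 2 * z / Real.sqrt μ) := by
  have hμ' : (0 : ℝ) < μ := Nat.cast_pos.2 hμ
  have h1 : Real.sqrt (M / 2) = Real.sqrt M * Real.sqrt 2 / 2 := by
    rw [Real.sqrt_div hM.le, div_eq_div_iff (by positivity) two_ne_zero, mul_assoc,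
      Real.mul_self_sqrt zero_le_two]
  have h2 := Real.mul_self_sqrt hM.le
  have h3 : (μ : ℝ) = Real.sqrt μ * Real.sqrt μ := (Real.mul_self_sqrt hμ'.le).symm
  have h4 : 0 < Real.sqrt μ := Real.sqrt_pos.2 hμ'
  rw [h1]
  have h5 : 4 / (μ : ℝ) = 4 / (Real.sqrt μ * Real.sqrt μ) := by rw [← h3]
  rw [h5]
  field_simp
  linear_combination (4 * z) * h2

theorem sqrt_div_two_mul (L : ℝ) (hL : 0 ≤ L) (μ : ℕ) :
    Real.sqrt (L / (2 * μ)) = Real.sqrt (L / 2) / Real.sqrt μ := by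
  rw [← div_div, Real.sqrt_div (by positivity)]

theorem sqrt_mean_eq {a : ℝ} (ha : 0 ≤ a) (μ : ℕ) :
    Real.sqrt (4 * a / (3 * μ)) = Real.sqrt (4 * a / 3) / Real.sqrt μ := by
  rw [← div_div, Real.sqrt_div (by positivity)]

/-! ### The two uniform deviation bounds. -/

section process

variable {Ω : Type*} [MeasurableSpace Ω] {P : Measure Ω} {X : ℤ → Ω → ℝ}

theorem integrable_of_lintegral_subsampleNorm (hX : ∀ t, Measurable (X t))
    (hstat : IsStationary P X) {μ m : ℕ} (hμ : 0 < μ)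
    (h : ∫⁻ ω, ENNReal.ofReal (subsampleNorm X μ m ω) ∂P ≠ ⊤) : Integrable (X 0) P := by
  have hm := measurable_subsampleNorm hX μ m
  have hi : Integrable (subsampleNorm X μ m) P :=
    (lintegral_ofReal_ne_top_iff_integrable hm.aestronglyMeasurable
      (Eventually.of_forall fun ω => subsampleNorm_nonneg X μ m ω)).1 h
  have h1 : Integrable (X ((m / 2 + 2 * m * 0 : ℕ) : ℤ)) P := by
    refine hi.mono (hX _).aestronglyMeasurable (Eventually.of_forall fun ω => ?_)
    rw [Real.norm_eq_abs, Real.norm_of_nonneg (subsampleNorm_nonneg X μ m ω)]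
    exact abs_le_subsampleNorm X hμ ω
  exact (identDistrib_zero (P := P) hX hstat _).integrable_iff.1 h1

/-- Cauchy–Schwarz bounds the sum of absolute values by `√μ` times the norm, and stationarity gives
all summands the same mean. This reduces the expected norm to the first moment. -/
theorem ofReal_sqrt_mul_integral_abs_le (hX : ∀ t, Measurable (X t)) (hstat : IsStationary P X)
    {μ m : ℕ} (hint : Integrable (X 0) P) (hμ : 0 < μ) :
    ENNReal.ofReal (Real.sqrt μ * ∫ ω, |X 0 ω| ∂P) ≤
      ∫⁻ ω, ENNReal.ofReal (subsampleNorm X μ m ω) ∂P := by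
  have hμ' : (0 : ℝ) < μ := Nat.cast_pos.2 hμ
  have hsμ : 0 < Real.sqrt μ := Real.sqrt_pos.2 hμ'
  have hk : ∀ t : ℕ, Integrable (fun ω => |X (t : ℤ) ω|) P ∧
      ∫ ω, |X (t : ℤ) ω| ∂P = ∫ ω, |X 0 ω| ∂P := by
    intro t
    have hid := (identDistrib_zero (P := P) hX hstat t).comp (u := fun x => |x|) (by fun_prop)
    exact ⟨hid.integrable_iff.2 hint.abs, hid.integral_eq⟩
  have hi : Integrable (fun ω => (∑ k ∈ Finset.range μ,
      |X ((m / 2 + 2 * m * k : ℕ) : ℤ) ω|) / Real.sqrt μ) P :=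
    (integrable_finsetSum _ fun k _ => (hk _).1).div_const _
  have h1 : ∫ ω, (∑ k ∈ Finset.range μ, |X ((m / 2 + 2 * m * k : ℕ) : ℤ) ω|) / Real.sqrt μ ∂P =
      Real.sqrt μ * ∫ ω, |X 0 ω| ∂P := by
    rw [integral_div, integral_finsetSum _ fun k _ => (hk _).1]
    simp only [(hk _).2, Finset.sum_const, Finset.card_range, nsmul_eq_mul]
    rw [div_eq_iff hsμ.ne', mul_right_comm, Real.mul_self_sqrt hμ'.le]
  rw [← h1, ofReal_integral_eq_lintegral_ofReal hi (Eventually.of_forall fun ω =>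
    div_nonneg (Finset.sum_nonneg fun _ _ => abs_nonneg _) hsμ.le)]
  refine lintegral_mono fun ω => ENNReal.ofReal_le_ofReal ?_
  rw [div_le_iff₀ hsμ]
  exact (sum_abs_le_subsampleNorm X μ m ω).trans_eq (mul_comm _ _)

variable [IsProbabilityMeasure P]

/-- Because `min(u², 1) ≤ |u|`, a small first moment forces a small risk; this is what activates the
reduced variance proxy. -/
theorem pairRisk_one_le (hX : ∀ t, Measurable (X t)) (hstat : IsStationary P X) (c : ℝ)
    (hint : Integrable (fun ω => |X 0 ω / c|) P) {φ : ℝ} (hφ : |φ| ≤ 1) :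
    pairRisk P X (fun _ => 1) c φ ≤ 2 * ∫ ω, |X 0 ω / c| ∂P := by
  have hid := (identDistrib_zero (P := P) hX hstat 1).comp (u := fun x => |x / c|) (by fun_prop)
  have hint1 : Integrable (fun ω => |X 1 ω / c|) P := by
    simpa [Function.comp_def] using hid.integrable_iff.2 hint
  have heq : ∫ ω, |X 1 ω / c| ∂P = ∫ ω, |X 0 ω / c| ∂P := by
    simpa [Function.comp_def] using hid.integral_eq
  have hle : pairRisk P X (fun _ => 1) c φ ≤ ∫ ω, (|X 1 ω / c| + |X 0 ω / c|) ∂P := by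
    refine integral_mono (integrable_weightedLoss hX measurable_const
      (fun _ => ⟨zero_le_one, le_rfl⟩) c φ 0 1) (hint1.add hint) fun ω => ?_
    simp only [weightedLoss, one_mul]
    refine (truncLoss_one_le_abs _ _).trans ((abs_sub _ _).trans ?_)
    rw [abs_mul]
    have := mul_le_mul_of_nonneg_right hφ (abs_nonneg (X 0 ω / c))
    linarith
  rw [integral_add hint1 hint, heq] at hle
  linarith

theorem pairRisk_one_le_truncWeight (hX : ∀ t, Measurable (X t)) (c φ T : ℝ) :
    pairRisk P X (fun _ => 1) c φ ≤
      pairRisk P X (truncWeight T) c φ + P.real {ω | T < |X 0 ω / c|} := by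
  have hms : MeasurableSet {ω | T < |X 0 ω / c|} :=
    measurableSet_lt measurable_const ((hX 0).div_const c).abs
  have hi := integrable_weightedLoss (P := P) hX (measurable_truncWeight T)
    (truncWeight_mem_Icc T) c φ 0 1
  have h1 : ∫ ω, {ω | T < |X 0 ω / c|}.indicator (fun _ => (1 : ℝ)) ω ∂P =
      P.real {ω | T < |X 0 ω / c|} := by
    rw [integral_indicator_const _ hms]; simp
  have hii : Integrable ({ω | T < |X 0 ω / c|}.indicator (fun _ => (1 : ℝ))) P :=
    (integrable_const _).indicator hms
  rw [← h1, pairRisk, pairRisk, ← integral_add hi hii]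
  refine integral_mono (integrable_weightedLoss hX measurable_const
    (fun _ => ⟨zero_le_one, le_rfl⟩) c φ 0 1) (hi.add hii) fun ω => ?_
  have h2 := truncLoss_one_mem_Icc (X 1 ω / c) (φ * (X 0 ω / c))
  simp only [weightedLoss, truncWeight, one_mul, Set.indicator_apply, Set.mem_ofPred_eq]
  rcases le_or_gt (|X 0 ω / c|) T with h | h
  · simp [h, not_lt.2 h]
  · simp [h, not_le.2 h, h2.2]

theorem measure_exists_coeff_of_integrable_le (hX : ∀ t, Measurable (X t))
    (hstat : IsStationary P X) {M : ℝ} (hM : 0 < M) {μ m : ℕ} (hμ : 0 < μ) (hm : 0 < m) {L : ℝ}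
    (hL : Real.log 2 ≤ L) (hint : Integrable (X 0) P) :
    P {ω | ∃ φ ∈ stabilityDomain 1, trainingError X M (2 * μ * m) φ ω +
        (4 / (μ : ℝ) * Real.sqrt (M / 2) * (Real.sqrt μ * ∫ ω, |X 0 ω| ∂P) +
          M * Real.sqrt (L / (2 * μ))) < risk P X M (2 * μ * m) φ} ≤
      ENNReal.ofReal (2 * Real.exp (-L) + 2 * ((μ : ℝ) - 1) * betaCoeff P X m) := by
  have hμ' : (0 : ℝ) < μ := Nat.cast_pos.2 hμ
  have hL0 : 0 ≤ L := (Real.log_nonneg one_le_two).trans hL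
  have hsM : 0 < Real.sqrt M := Real.sqrt_pos.2 hM
  have hsμ : 0 < Real.sqrt μ := Real.sqrt_pos.2 hμ'
  set c := Real.sqrt M with hc
  set a := ∫ ω, |X 0 ω / c| ∂P with ha
  have hintc : Integrable (fun ω => |X 0 ω / c|) P := (hint.div_const c).abs
  have ha0 : 0 ≤ a := integral_nonneg fun _ => abs_nonneg _
  have haX : ∫ ω, |X 0 ω| ∂P = c * a := by
    simp only [ha, abs_div, abs_of_pos hsM]
    rw [integral_div]
    field_simp
  have hl : 0.588 ≤ Real.sqrt (L / 2) := by
    apply Real.le_sqrt_of_sq_le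
    linarith [Real.log_two_gt_d9]
  obtain ⟨θ, hθ0, hθv, hθ⟩ := exists_variance_factor ha0 hl
  set l := Real.sqrt (L / 2) with hldef
  have hl2 : l ^ 2 = L / 2 := Real.sq_sqrt (by positivity)
  refine measure_exists_coeff_le hX hM.le _ _ fun K hK => ?_
  -- The factor `θ` scales both the standard deviation proxy and the threshold, so the exponent is
  -- exactly `L`.
  have hev := fun s => measure_blocks_deviation_le (P := P) hX hstat
    (w := fun _ => 1) measurable_const (fun _ => ⟨zero_le_one, le_rfl⟩) c hK hm hμ s
    (by simpa using hintc) (a := a) (by simp [ha]) (r := 2 * a) (v := θ ^ 2 / 4)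
    (t := θ * (l / Real.sqrt μ))
    (fun i hi => pairRisk_one_le hX hstat c hintc (abs_gridPt_le hK hi)) hθv (by positivity)
    (by positivity)
  have hexp : (μ : ℝ) * (θ * (l / Real.sqrt μ)) ^ 2 / (2 * (θ ^ 2 / 4)) = L := by
    rw [mul_pow, div_pow, hl2, Real.sq_sqrt hμ'.le]
    field_simp
    ring
  rw [hexp] at hev
  have hβ := betaCoeff_nonneg P X m
  have hμ1 : (0 : ℝ) ≤ (μ : ℝ) - 1 := by
    have : (1 : ℝ) ≤ μ := by exact_mod_cast hμ
    linarith
  refine (measure_mono ?_).trans ((measure_union_le _ _).trans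
    ((add_le_add (hev 1) (hev (m + 1))).trans_eq ?_))
  · rintro ω ⟨i, hi, h⟩
    rw [risk_eq_pairRisk hX hstat hM, trainingError_eq_blockRisk hM hμ hm, haX,
      mul_left_comm (Real.sqrt μ) c a, norm_term_eq hM hμ, sqrt_div_two_mul L hL0, ← mul_add,
      ← mul_add] at h
    have h1 := lt_of_mul_lt_mul_left h hM.le
    have h2 : Real.sqrt (4 * a / (3 * μ)) + θ * (l / Real.sqrt μ) ≤
        2 * Real.sqrt 2 * a / Real.sqrt μ + l / Real.sqrt μ := by
      rw [sqrt_mean_eq ha0, ← mul_div_assoc, ← add_div, ← add_div]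
      exact div_le_div_of_nonneg_right hθ hsμ.le
    rcases le_total (blockRisk X (fun _ => 1) c K m μ 1 i ω)
      (blockRisk X (fun _ => 1) c K m μ (m + 1) i ω) with h3 | h3
    · exact Or.inl ⟨i, hi, by linarith⟩
    · exact Or.inr ⟨i, hi, by linarith⟩
  · rw [← ENNReal.ofReal_add (by positivity) (by positivity)]
    congr 1
    ring

theorem measure_exists_coeff_of_norm_le (hX : ∀ t, Measurable (X t))
    (hstat : IsStationary P X) {M : ℝ} (hM : 0 < M) {μ m : ℕ} (hμ : 0 < μ) (hm : 0 < m) {L : ℝ}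
    (hL : Real.log 4 ≤ L) :
    P {ω | ∃ φ ∈ stabilityDomain 1, trainingError X M (2 * μ * m) φ ω +
        (4 / (μ : ℝ) * Real.sqrt (M / 2) * subsampleNorm X μ m ω +
          3 * M * Real.sqrt (L / (2 * μ))) < risk P X M (2 * μ * m) φ} ≤
      ENNReal.ofReal (3 * Real.exp (-L) + 3 * ((μ : ℝ) - 1) * betaCoeff P X m) := by
  have hμ' : (0 : ℝ) < μ := Nat.cast_pos.2 hμ
  have hL4 : 1.386 ≤ L := by
    have : Real.log 4 = 2 * Real.log 2 := by
      rw [show (4 : ℝ) = 2 ^ 2 by norm_num, Real.log_pow]; norm_num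
    linarith [Real.log_two_gt_d9]
  have hL0 : 0 ≤ L := by linarith
  have hsM : 0 < Real.sqrt M := Real.sqrt_pos.2 hM
  have hsμ : 0 < Real.sqrt μ := Real.sqrt_pos.2 hμ'
  have hsμ2 : Real.sqrt μ ^ 2 = μ := Real.sq_sqrt hμ'.le
  set c := Real.sqrt M with hc
  set l := Real.sqrt (L / 2) with hldef
  have hl2 : l ^ 2 = L / 2 := Real.sq_sqrt (by positivity)
  have hl : 0.83 ≤ l := by
    apply Real.le_sqrt_of_sq_le
    norm_num
    linarith
  have hβ := betaCoeff_nonneg P X m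
  have hμ1 : (0 : ℝ) ≤ (μ : ℝ) - 1 := by
    have : (1 : ℝ) ≤ μ := by exact_mod_cast hμ
    linarith
  -- The tail mass `2L/μ` makes the failure probability of the norm estimate `exp (-L)`, while its
  -- cost in risk stays of order `L/μ`.
  obtain ⟨T, hT0, hTp, hTm⟩ := exists_truncation_level (P := P) (ξ := fun ω => |X 0 ω / c|)
    ((hX 0).div_const c).abs (r := 2 * L / μ) (by positivity)
  set m2 := ∫ ω, min (|X 0 ω / c| ^ 2) (T ^ 2) ∂P with hm2
  have hm20 : 0 ≤ m2 := integral_nonneg fun _ => le_min (sq_nonneg _) (sq_nonneg _)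
  set a := Real.sqrt m2 with ha
  have ha0 : 0 ≤ a := Real.sqrt_nonneg _
  have ha2 : a ^ 2 = m2 := Real.sq_sqrt hm20
  -- the truncated first moment
  have hwle : ∀ x : ℝ, truncWeight T x * |x| ≤ T := by
    intro x
    unfold truncWeight
    split_ifs with h
    · simpa using h
    · simpa using hT0
  have hwm : Measurable fun ω => truncWeight T (X 0 ω / c) * |X 0 ω / c| :=
    ((measurable_truncWeight T).comp ((hX 0).div_const c)).mul ((hX 0).div_const c).abs
  have hw0 : ∀ ω, 0 ≤ truncWeight T (X 0 ω / c) * |X 0 ω / c| := fun ω =>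
    mul_nonneg (truncWeight_mem_Icc T _).1 (abs_nonneg _)
  have hwL2 : MemLp (fun ω => truncWeight T (X 0 ω / c) * |X 0 ω / c|) 2 P := by
    refine MemLp.of_bound hwm.aestronglyMeasurable T (Eventually.of_forall fun ω => ?_)
    rw [Real.norm_eq_abs, abs_of_nonneg (hw0 ω)]
    exact hwle _
  have hwint : Integrable (fun ω => truncWeight T (X 0 ω / c) * |X 0 ω / c|) P :=
    hwL2.integrable one_le_two
  have hwa : ∫ ω, truncWeight T (X 0 ω / c) * |X 0 ω / c| ∂P ≤ a := by
    refine integral_le_sqrt_of_sq_le hwL2 (integral_mono hwL2.integrable_sq ?_ fun ω => ?_)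
    · have hx : Measurable fun ω => |X 0 ω / c| := ((hX 0).div_const c).abs
      exact Integrable.of_mem_Icc 0 (T ^ 2) ((hx.pow_const 2).min measurable_const).aemeasurable
        (Eventually.of_forall fun ω => ⟨le_min (sq_nonneg _) (sq_nonneg _), min_le_right _ _⟩)
    · refine le_min ?_ (pow_le_pow_left₀ (hw0 ω) (hwle _) 2)
      refine pow_le_pow_left₀ (hw0 ω) ?_ 2
      exact mul_le_of_le_one_left (abs_nonneg _) (truncWeight_mem_Icc T _).2
  have hnorm := measure_sum_min_sq_lt_le (P := P) hX hstat c (m := m) hμ (m / 2) hT0 hTm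
  have hexpn : (μ : ℝ) * (2 * L / μ) / 2 = L := by field_simp
  rw [hexpn] at hnorm
  refine measure_exists_coeff_le hX hM.le _ _ fun K hK => ?_
  have hev := fun s => measure_blocks_deviation_le (P := P) hX hstat
    (measurable_truncWeight T) (truncWeight_mem_Icc T) c hK hm hμ s
    hwint hwa (r := 1) (v := 1 / 4) (t := l / Real.sqrt μ)
    (fun i hi => by
      refine (integral_mono (integrable_weightedLoss hX (measurable_truncWeight T)
        (truncWeight_mem_Icc T) c _ 0 1) (integrable_const (1 : ℝ)) fun ω =>
          (weightedLoss_mem_Icc (truncWeight_mem_Icc T) _ _ _).2).trans ?_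
      simp) (Or.inl le_rfl) (by norm_num) (by positivity)
  have hexp : (μ : ℝ) * (l / Real.sqrt μ) ^ 2 / (2 * (1 / 4)) = L := by
    rw [div_pow, hl2, hsμ2]
    field_simp
    ring
  rw [hexp] at hev
  -- Three bad events: the empirical norm is too small, or one of the two block families deviates.
  refine (measure_mono (t := {ω | ∑ k ∈ Finset.range μ,
      min (|X ((m / 2 + 2 * m * k : ℕ) : ℤ) ω / c| ^ 2) (T ^ 2) < 0.16 * (μ * m2)} ∪ (_ ∪ _)) ?_).trans
    ((measure_union_le _ _).trans ((add_le_add hnorm ((measure_union_le _ _).trans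
      (add_le_add (hev 1) (hev (m + 1))))).trans_eq ?_))
  · rintro ω ⟨i, hi, h⟩
    rw [Set.mem_union]
    by_cases hbad : ∑ k ∈ Finset.range μ,
      min (|X ((m / 2 + 2 * m * k : ℕ) : ℤ) ω / c| ^ 2) (T ^ 2) < 0.16 * (μ * m2)
    · exact Or.inl hbad
    right
    push Not at hbad
    obtain ⟨y, hyp, hyn⟩ : ∃ y, 0 ≤ y ∧ subsampleNorm X μ m ω = c * (Real.sqrt μ * y) :=
      ⟨subsampleNorm X μ m ω / (c * Real.sqrt μ),
        div_nonneg (subsampleNorm_nonneg X μ m ω) (by positivity), by field_simp⟩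
    -- Here `0.4 = √0.16`, the square root of the fraction of the mean retained by the lower-tail
    -- estimate.
    have hya : 0.4 * a ≤ y := by
      have h1 : 0.16 * (μ * m2) ≤ subsampleNorm X μ m ω ^ 2 / c ^ 2 := by
        refine hbad.trans ?_
        unfold subsampleNorm
        rw [Real.sq_sqrt (Finset.sum_nonneg fun _ _ => sq_nonneg _), Finset.sum_div]
        refine Finset.sum_le_sum fun k _ => (min_le_left _ _).trans_eq ?_
        rw [sq_abs, div_pow]
      have h2 : subsampleNorm X μ m ω ^ 2 / c ^ 2 = μ * y ^ 2 := by
        rw [hyn, mul_pow, mul_pow, hsμ2]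
        field_simp
      rw [h2] at h1
      have h3 : (0.4 * a) ^ 2 ≤ y ^ 2 := by
        rw [mul_pow, ha2]
        have : (μ : ℝ) * (0.16 * m2) ≤ μ * y ^ 2 := by linarith
        have := le_of_mul_le_mul_left this hμ'
        norm_num
        linarith
      exact (sq_le_sq₀ (by positivity) hyp).1 h3
    rw [risk_eq_pairRisk hX hstat hM, trainingError_eq_blockRisk hM hμ hm, hyn,
      norm_term_eq hM hμ, sqrt_div_two_mul L hL0, mul_comm (3 : ℝ) M, mul_assoc M 3, ← mul_add,
      ← mul_add] at h
    have h1 := lt_of_mul_lt_mul_left h hM.le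
    have htr := pairRisk_one_le_truncWeight (P := P) hX c (gridPt K i) T
    have hb1 := blockRisk_truncWeight_le X c T K m μ 1 i ω
    have hb2 := blockRisk_truncWeight_le X c T K m μ (m + 1) i ω
    have hbn : ∀ s, 0 ≤ blockRisk X (fun _ => 1) c K m μ s i ω := fun s =>
      mul_nonneg (by positivity) (Finset.sum_nonneg fun k _ =>
        (blockLoss_mem_Icc (fun _ => ⟨zero_le_one, le_rfl⟩) c K hm _ i).1)
    have hpr1 : pairRisk P X (fun _ => 1) c (gridPt K i) ≤ 1 := by
      refine (integral_mono (integrable_weightedLoss hX measurable_const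
        (fun _ => ⟨zero_le_one, le_rfl⟩) c _ 0 1) (integrable_const (1 : ℝ)) fun ω =>
          (weightedLoss_mem_Icc (fun _ => ⟨zero_le_one, le_rfl⟩) _ _ _).2).trans ?_
      simp
    have hy0 : 0 ≤ 2 * Real.sqrt 2 * y / Real.sqrt μ := by positivity
    -- the bound is trivial when the sample is too small
    have h3l : 3 * l < Real.sqrt μ := by
      have : 3 * (l / Real.sqrt μ) < 1 := by linarith [hbn 1, hbn (m + 1)]
      rw [← mul_div_assoc, div_lt_one hsμ] at this
      exact this
    have h2 : Real.sqrt (4 * a / (3 * μ)) + l / Real.sqrt μ + 2 * L / μ ≤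
        2 * Real.sqrt 2 * y / Real.sqrt μ + 3 * (l / Real.sqrt μ) := by
      have hLμ : 2 * L / μ = (4 * l ^ 2 / Real.sqrt μ) / Real.sqrt μ := by
        rw [hl2, div_div, ← sq, hsμ2]; ring
      rw [sqrt_mean_eq ha0, hLμ, ← mul_div_assoc, ← add_div, ← add_div, ← add_div]
      refine div_le_div_of_nonneg_right ?_ hsμ.le
      -- Since `3 l < √μ`, the quadratic truncation cost is linear in `l`.
      have e1 : 4 * l ^ 2 / Real.sqrt μ ≤ 4 / 3 * l := by
        rw [div_le_iff₀ hsμ]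
        nlinarith
      have e2 := sqrt_le_half_add (x := 4 * a / 3) (k := 0.6) (by positivity) (by norm_num)
      have e3 : 2.828 * y ≤ 2 * Real.sqrt 2 * y :=
        mul_le_mul_of_nonneg_right le_two_mul_sqrt_two (by linarith)
      have e4 : (4 * a / 3 / 0.6 + 0.6) / 2 ≤ 1.112 * a + 0.3 := by norm_num; linarith
      -- The slope fits since `1.112 / 0.4 = 2.78 ≤ 2.828`. The constant fits since `0.3 + l + (4/3)
      -- l ≤ 3 l` for `l ≥ 0.45`.
      linarith
    rcases le_total (blockRisk X (fun _ => 1) c K m μ 1 i ω)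
      (blockRisk X (fun _ => 1) c K m μ (m + 1) i ω) with h3 | h3
    · exact Or.inl ⟨i, hi, by linarith⟩
    · exact Or.inr ⟨i, hi, by linarith⟩
  · rw [← ENNReal.ofReal_add (by positivity) (by positivity),
      ← ENNReal.ofReal_add (by positivity) (by positivity)]
    congr 1
    ring

end process

end ARRisk

/-! ### The two risk bounds. -/

theorem corollary1 {Ω : Type*} [MeasurableSpace Ω] (P : Measure Ω) [IsProbabilityMeasure P]
    (X : ℤ → Ω → ℝ) (hX : ∀ t, Measurable (X t))
    (hstat : ARRisk.IsStationary P X) (hmix : ARRisk.IsBetaMixing P X)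
    (M : ℝ) (hM : 0 ≤ M) (n μ m : ℕ) (hμ : 0 < μ) (hm : 0 < m) (hn : 2 * μ * m = n)
    (η : ℝ) (hη : 4 * ((μ : ℝ) - 1) * ARRisk.betaCoeff P X m < η) :
    (∀ η' : ℝ, η' = η - 4 * ((μ : ℝ) - 1) * ARRisk.betaCoeff P X m →
      ENNReal.ofReal (1 - η) ≤
        P {ω | ∀ φ ∈ ARRisk.stabilityDomain 1,
          ARRisk.risk P X M n φ ≤
            ARRisk.trainingError X M n φ ω
              + 4 / (μ : ℝ) * Real.sqrt (M / 2) * ARRisk.subsampleNorm X μ m ω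
              + 3 * M * Real.sqrt (Real.log (4 / η') / (2 * (μ : ℝ)))}) ∧
    (∀ η' : ℝ, η' = η - 2 * ((μ : ℝ) - 1) * ARRisk.betaCoeff P X m →
      ENNReal.ofReal (1 - η) ≤
        P {ω | ∀ φ ∈ ARRisk.stabilityDomain 1,
          ENNReal.ofReal (ARRisk.risk P X M n φ) ≤
            ENNReal.ofReal (ARRisk.trainingError X M n φ ω)
              + ENNReal.ofReal (4 / (μ : ℝ) * Real.sqrt (M / 2))
                * ∫⁻ ω', ENNReal.ofReal (ARRisk.subsampleNorm X μ m ω') ∂P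
              + ENNReal.ofReal
                  (M * Real.sqrt (Real.log (2 / η') / (2 * (μ : ℝ))))}) := by
  have hμ' : (0 : ℝ) < μ := Nat.cast_pos.2 hμ
  have hβ := ARRisk.betaCoeff_nonneg P X m
  have hμ1 : (0 : ℝ) ≤ (μ : ℝ) - 1 := by
    have : (1 : ℝ) ≤ μ := by exact_mod_cast hμ
    linarith
  have hb : 0 ≤ ((μ : ℝ) - 1) * ARRisk.betaCoeff P X m := mul_nonneg hμ1 hβ
  have hη0 : 0 < η := by nlinarith
  subst hn
  have htrain : ∀ (φ : Fin 1 → ℝ) ω, 0 ≤ ARRisk.trainingError X M (2 * μ * m) φ ω := fun φ ω =>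
    mul_nonneg (by positivity) (Finset.sum_nonneg fun t _ => ARRisk.truncLoss_nonneg hM _ _)
  -- the degenerate cases
  rcases le_or_gt 1 η with h1 | h1
  · rw [ENNReal.ofReal_of_nonpos (by linarith)]
    exact ⟨fun _ _ => zero_le, fun _ _ => zero_le⟩
  rcases hM.eq_or_lt with rfl | hM0
  · have hrisk : ∀ φ : Fin 1 → ℝ, ARRisk.risk P X 0 (2 * μ * m) φ ≤ 0 := fun φ =>
      integral_nonpos fun ω => ARRisk.truncLoss_le 0 _ _
    have huniv : ∀ W : Set Ω, (∀ ω, ω ∈ W) → ENNReal.ofReal (1 - η) ≤ P W := fun W hW => by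
      rw [Set.eq_univ_of_forall hW, measure_univ]
      exact ENNReal.ofReal_le_one.2 (by linarith)
    refine ⟨fun η' _ => huniv _ fun ω φ _ => ?_, fun η' _ => huniv _ fun ω φ _ => ?_⟩
    · have := htrain φ ω
      have := hrisk φ
      simp
      linarith
    · rw [ENNReal.ofReal_of_nonpos (hrisk φ)]
      exact zero_le
  constructor
  · intro η' hη'
    have hη'0 : 0 < η' := by linarith
    have hlog : Real.exp (-Real.log (4 / η')) = η' / 4 := by
      rw [← Real.log_inv, Real.exp_log (by positivity), inv_div]
    have hL : Real.log 4 ≤ Real.log (4 / η') := by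
      apply Real.log_le_log (by norm_num)
      rw [le_div_iff₀ hη'0]
      nlinarith
    refine ARRisk.ofReal_one_sub_le_measure hη0.le
      ((ARRisk.measure_exists_coeff_of_norm_le hX hstat hM0 hμ hm hL).trans
        (ENNReal.ofReal_le_ofReal ?_)) fun ω hω φ hφ => ?_
    -- The failure probability is `(3/4) η' + 3 (μ - 1) β(m)`, which leaves some room below `η`; in
    -- the second assertion the corresponding sum equals `η`.
    · rw [hlog]; linarith
    · by_contra hcon
      exact hω ⟨φ, hφ, by linarith [not_le.1 hcon]⟩
  · intro η' hη'
    have hη'0 : 0 < η' := by nlinarith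
    have hlog : Real.exp (-Real.log (2 / η')) = η' / 2 := by
      rw [← Real.log_inv, Real.exp_log (by positivity), inv_div]
    have hL : Real.log 2 ≤ Real.log (2 / η') := by
      apply Real.log_le_log (by norm_num)
      rw [le_div_iff₀ hη'0]
      nlinarith
    have hC : 0 < 4 / (μ : ℝ) * Real.sqrt (M / 2) := by positivity
    -- An infinite expected norm makes the bound void; a finite one gives the integrability of `X 0`
    -- needed for the first-moment argument.
    by_cases htop : ∫⁻ ω, ENNReal.ofReal (ARRisk.subsampleNorm X μ m ω) ∂P = ⊤
    · rw [htop, ENNReal.mul_top (ENNReal.ofReal_pos.2 hC).ne']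
      simp only [add_top, top_add, le_top, implies_true, Set.ofPred_true, measure_univ]
      exact ENNReal.ofReal_le_one.2 (by linarith)
    have hint := ARRisk.integrable_of_lintegral_subsampleNorm hX hstat hμ htop
    have hnorm := ARRisk.ofReal_sqrt_mul_integral_abs_le (m := m) hX hstat hint hμ
    refine ARRisk.ofReal_one_sub_le_measure hη0.le
      ((ARRisk.measure_exists_coeff_of_integrable_le hX hstat hM0 hμ hm hL hint).trans
        (ENNReal.ofReal_le_ofReal ?_)) fun ω hω φ hφ => ?_
    · rw [hlog]; linarith
    · have hle : ARRisk.risk P X M (2 * μ * m) φ ≤ ARRisk.trainingError X M (2 * μ * m) φ ω +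
          (4 / (μ : ℝ) * Real.sqrt (M / 2) * (Real.sqrt μ * ∫ ω, |X 0 ω| ∂P) +
          M * Real.sqrt (Real.log (2 / η') / (2 * μ))) := by
        by_contra hcon
        exact hω ⟨φ, hφ, not_le.1 hcon⟩
      have hE : 0 ≤ ∫ ω, |X 0 ω| ∂P := integral_nonneg fun _ => abs_nonneg _
      refine (ENNReal.ofReal_le_ofReal hle).trans ?_
      rw [ENNReal.ofReal_add (htrain φ ω) (by positivity),
        ENNReal.ofReal_add (by positivity) (by positivity), ENNReal.ofReal_mul hC.le, ← add_assoc]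
      gcongr
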